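/- Let $p$ be a prime, let $\overline{\mathbb Q_p}$ be an algebraic closure of $\mathbb Q_p$ with the absolute value $|\cdot|_p$ extending the $p$-adic one, and let all homomorphisms of topological groups be continuous. Let $F_n$ be the free pro-$p$ group on $g_1,\dots,g_n$, let $r_1,\dots,r_m\in F_n$, and let $$\pi\colon F_n\to G=\langle g_1,\dots,g_n\mid r_1=\cdots=r_m=1\rangle^{\text{pro-}p}$$ be the quotient of $F_n$ by the closed normal subgroup generated by $r_1,\dots,r_m$. Let $\Gamma=\mathbb Z_p$ (written multiplicatively), let $\gamma$ be a topological generator of $\Gamma$, and suppose that $\alpha\colon G\to\Gamma$ is a surjective homomorphism with $\alpha(\pi(g_i))=\gamma$ for all $i$ (so all relators have total degree $0$). Let $k\ge 2$, let $\varphi_{k-2}\colon F_n\to \mathrm{GL}(k-1;\overline{\mathbb Q_p})$ be a homomorphism, and let $$\widetilde{\varphi_{k-2}}\colon F_n\to \mathrm{GL}(k-1;\overline{\mathbb Q_p}\otimes_{\mathbb Z_p}\mathbb Z_p[[\Gamma]]),\qquad \widetilde{\varphi_{k-2}}(x)=\varphi_{k-2}(x)\cdot\alpha(\pi(x)).$$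 Extend $\widetilde{\varphi_{k-2}}$ linearly and continuously to the complete group algebra $\mathbb Z_p[[F_n]]$, and let $Q$ be the $m(k-1)\times n(k-1)$ matrix whose $(j,i)$ block is $\widetilde{\varphi_{k-2}}\left(\partial r_j/\partial g_i\right)$, where $\partial/\partial g_i\colon\mathbb Z_p[[F_n]]\to\mathbb Z_p[[F_n]]$ is the pro-$p$ Fox derivative. Let $\Delta_{k-1}(A_{\widetilde{\varphi_{k-2}}})\in\overline{\mathbb Q_p}\otimes_{\mathbb Z_p}\mathbb Z_p[[\Gamma]]$ be the greatest common divisor (unique up to units) of the minors of $Q$ of size $n(k-1)-(k-1)$; it is $0$ if $Q$ has no minors of this size. Let $a_{k-1}\in\overline{\mathbb Q_p}^{\times}$ with $|a_{k-1}-1|_p<1$, and write $|_{\gamma=a_{k-1}}$ for the specialization $\overline{\mathbb Q_p}\otimes_{\mathbb Z_p}\mathbb Z_p[[\Gamma]]\to\overline{\mathbb Q_p}$ that substitutes $a_{k-1}$ for $\gamma$. Let $\rho_{k-2}\colon G\to\mathrm{GL}(k-1;\overline{\mathbb Q_p})$ be a representation such that $\rho_{k-2}\circ\pi=\widetilde{\varphi_{k-2}}|_{\gamma=a_{k-1}}$.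 Let $H^1(G,(\overline{\mathbb Q_p}^{\oplus(k-1)})_{\rho_{k-2}})$ be the first continuous cohomology group, that is, the space of continuous maps $\beta\colon G\to\overline{\mathbb Q_p}^{\oplus(k-1)}$ with $\beta(xy)=\beta(x)+\rho_{k-2}(x)\beta(y)$ modulo the space of the maps $x\mapsto\rho_{k-2}(x)v-v$. Assume that the matrices $\rho_{k-2}(x)$, $x\in G$, have no simultaneous eigenvector with simultaneous eigenvalue $1$, i.e. there is no $v\ne 0$ with $\rho_{k-2}(x)v=v$ for all $x\in G$. If $H^1(G,(\overline{\mathbb Q_p}^{\oplus(k-1)})_{\rho_{k-2}})\neq 0$, then $a_{k-1}$ is a zero of $\Delta_{k-1}(A_{\widetilde{\varphi_{k-2}}})$, i.e. $\Delta_{k-1}(A_{\widetilde{\varphi_{k-2}}})$ exists and $\Delta_{k-1}(A_{\widetilde{\varphi_{k-2}}})|_{\gamma=a_{k-1}}=0$. -/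

import Mathlib

open Filter Topology TensorProduct

noncomputable section

/-! ### Completed group algebras -/

section CompletedGroupAlgebra

variable (p : ℕ) [Fact p.Prime] (G : Type*) [Group G] [TopologicalSpace G]

/-- The transition map `ℤ_p[G/U] → ℤ_p[G/V]` for open normal subgroups `U ≤ V`. -/
def levelMap {U V : OpenNormalSubgroup G} (h : U ≤ V) :
    MonoidAlgebra ℤ_[p] (G ⧸ (U : Subgroup G)) →ₐ[ℤ_[p]]
      MonoidAlgebra ℤ_[p] (G ⧸ (V : Subgroup G)) :=
  MonoidAlgebra.mapDomainAlgHom ℤ_[p] ℤ_[p]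
    (QuotientGroup.map (U : Subgroup G) (V : Subgroup G) (MonoidHom.id G) fun _ hg => h hg)

/-- The inverse limit of the group algebras `ℤ_p[G/U]`, as a subalgebra of their product. -/
def completedSubalgebra :
    Subalgebra ℤ_[p] (∀ U : OpenNormalSubgroup G, MonoidAlgebra ℤ_[p] (G ⧸ (U : Subgroup G))) where
  carrier := {x | ∀ (U V : OpenNormalSubgroup G) (h : U ≤ V), levelMap p G h (x U) = x V}
  mul_mem' := by
    intro x y hx hy U V h
    simp only [Pi.mul_apply, map_mul, hx U V h, hy U V h]
  add_mem' := by
    intro x y hx hy U V h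
    simp only [Pi.add_apply, map_add, hx U V h, hy U V h]
  algebraMap_mem' := by
    intro c U V h
    simp only [Pi.algebraMap_apply, AlgHom.commutes]

/-- The complete group algebra `ℤ_p[[G]] = lim ℤ_p[G/U]`, where `U` runs through the open normal
subgroups of `G`. -/
def CompletedGroupAlgebra : Type _ := completedSubalgebra p G

namespace CompletedGroupAlgebra

instance : Ring (CompletedGroupAlgebra p G) := inferInstanceAs (Ring (completedSubalgebra p G))

instance : Algebra ℤ_[p] (CompletedGroupAlgebra p G) :=
  inferInstanceAs (Algebra ℤ_[p] (completedSubalgebra p G))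

/-- The image of an element of `ℤ_p[[G]]` in `ℤ_p[G/U]`. -/
def proj (U : OpenNormalSubgroup G) :
    CompletedGroupAlgebra p G →ₐ[ℤ_[p]] MonoidAlgebra ℤ_[p] (G ⧸ (U : Subgroup G)) :=
  (Pi.evalAlgHom ℤ_[p] _ U).comp (completedSubalgebra p G).val

variable {p G} in
theorem ext_proj {x y : CompletedGroupAlgebra p G} (h : ∀ U, proj p G U x = proj p G U y) :
    x = y :=
  Subtype.ext (funext h)

instance (H : Type*) [CommGroup H] [TopologicalSpace H] : CommRing (CompletedGroupAlgebra p H) :=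
  { (inferInstance : Ring (CompletedGroupAlgebra p H)) with
    mul_comm := fun x y => ext_proj fun U => by
      have hc : ∀ s t : MonoidAlgebra ℤ_[p] (H ⧸ (U : Subgroup H)), s * t = t * s :=
        fun s t => mul_comm s t
      rw [map_mul, map_mul, hc] }

/-- The coefficient of an element of `ℤ_p[[G]]` at a coset `c` of an open normal subgroup `U`. -/
def coeffAt (U : OpenNormalSubgroup G) (c : G ⧸ (U : Subgroup G)) :
    CompletedGroupAlgebra p G →ₗ[ℤ_[p]] ℤ_[p] where
  toFun x := (proj p G U x).coeff c
  map_add' := by intro x y; simp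
  map_smul' := by intro r x; simp

/-- The inverse limit topology on `ℤ_p[[G]]`: all coefficients are `p`-adically continuous. -/
instance : TopologicalSpace (CompletedGroupAlgebra p G) :=
  TopologicalSpace.induced
    (fun x (q : Σ U : OpenNormalSubgroup G, G ⧸ (U : Subgroup G)) => coeffAt p G q.1 q.2 x)
    inferInstance

/-- The canonical homomorphism from the abstract group algebra `ℤ_p[G]` to `ℤ_p[[G]]`. -/
def ofGroupAlgebra : MonoidAlgebra ℤ_[p] G →ₐ[ℤ_[p]] CompletedGroupAlgebra p G :=
  AlgHom.codRestrict
    (AlgHom.pi fun U : OpenNormalSubgroup G =>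
      MonoidAlgebra.mapDomainAlgHom ℤ_[p] ℤ_[p] (QuotientGroup.mk' (U : Subgroup G)))
    (completedSubalgebra p G) (by
      intro x U V h
      change ((levelMap p G h).comp (MonoidAlgebra.mapDomainAlgHom ℤ_[p] ℤ_[p]
        (QuotientGroup.mk' (U : Subgroup G)))) x = _
      rw [levelMap, ← MonoidAlgebra.mapDomainAlgHom_comp]
      rfl)

/-- The group element `g`, viewed in `ℤ_p[[G]]`. -/
def of : G →* CompletedGroupAlgebra p G :=
  (ofGroupAlgebra p G : MonoidAlgebra ℤ_[p] G →* CompletedGroupAlgebra p G).comp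
    (MonoidAlgebra.of ℤ_[p] G)

/-- The linear extension `ℤ_p[G] → M` of a map `f : G → M` to the abstract group algebra, followed
by its extension by continuity to `ℤ_p[[G]]`, in which the image of `ℤ_p[G]` is dense. -/
def extend {M : Type*} [AddCommGroup M] [Module ℤ_[p] M] [TopologicalSpace M] (f : G → M)
    (x : CompletedGroupAlgebra p G) : M :=
  haveI : Nonempty M := ⟨0⟩
  limUnder (comap (ofGroupAlgebra p G) (𝓝 x))
    (fun z : MonoidAlgebra ℤ_[p] G => Finsupp.linearCombination ℤ_[p] f z.coeff)

end CompletedGroupAlgebra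

end CompletedGroupAlgebra

/-! ### Free pro-`p` groups and presentations -/

section FreeProP

variable (p n : ℕ)

/-- The normal subgroups of `p`-power index in the free group on `n` letters. -/
def PPowerNormal : Type :=
  {N : Subgroup (FreeGroup (Fin n)) // N.Normal ∧ ∃ e : ℕ, N.index = p ^ e}

instance (N : PPowerNormal p n) : N.1.Normal := N.2.1

/-- The inverse limit of the quotients of `p`-power order of the free group on `n` letters, as a
subgroup of their product. -/
def freeProPSubgroup : Subgroup (∀ N : PPowerNormal p n, FreeGroup (Fin n) ⧸ N.1) where
  carrier := {x | ∀ (N M : PPowerNormal p n) (h : N.1 ≤ M.1),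
    QuotientGroup.map N.1 M.1 (MonoidHom.id _) h (x N) = x M}
  mul_mem' := by
    intro x y hx hy N M h
    simp only [Pi.mul_apply, map_mul, hx N M h, hy N M h]
  one_mem' := by
    intro N M h
    simp only [Pi.one_apply, map_one]
  inv_mem' := by
    intro x hx N M h
    simp only [Pi.inv_apply, map_inv, hx N M h]

/-- The free pro-`p` group on `n` generators: the pro-`p` completion of the free group. -/
def FreeProP : Type := freeProPSubgroup p n

namespace FreeProP

instance : Group (FreeProP p n) := inferInstanceAs (Group (freeProPSubgroup p n))

/-- The inverse limit topology, the finite quotients being discrete. -/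
instance : TopologicalSpace (FreeProP p n) :=
  TopologicalSpace.induced (fun x => x.1) (@Pi.topologicalSpace _ _ fun _ => ⊥)

instance : IsTopologicalGroup (FreeProP p n) := by
  let _ (N : PPowerNormal p n) : TopologicalSpace (FreeGroup (Fin n) ⧸ N.1) := ⊥
  have (N : PPowerNormal p n) : DiscreteTopology (FreeGroup (Fin n) ⧸ N.1) := ⟨rfl⟩
  exact topologicalGroup_induced (freeProPSubgroup p n).subtype

/-- The canonical homomorphism from the abstract free group. -/
def ofFreeGroup : FreeGroup (Fin n) →* FreeProP p n :=
  MonoidHom.codRestrict (MonoidHom.pi fun N : PPowerNormal p n => QuotientGroup.mk' N.1)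
    (freeProPSubgroup p n) (fun _ _ _ _ => rfl)

/-- The free generator `g_i`. -/
def gen (i : Fin n) : FreeProP p n := ofFreeGroup p n (FreeGroup.of i)

end FreeProP

variable {p n}

/-- `π : F_n → G` exhibits the topological group `G` as the pro-`p` group
`⟨g_1, …, g_n ∣ r_1 = ⋯ = r_m = 1⟩`: it is surjective, and its kernel is the closed normal subgroup
of `F_n` generated by the relators. -/
structure IsProPPresentation {m : ℕ} {G : Type*} [Group G] [TopologicalSpace G]
    (r : Fin m → FreeProP p n) (π : FreeProP p n →ₜ* G) : Prop where
  surjective : Function.Surjective π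
  ker_eq : (π : FreeProP p n →* G).ker =
    (Subgroup.normalClosure (Set.range r)).topologicalClosure

end FreeProP

/-! ### Fox derivatives -/

section Fox

variable (p : ℕ) [Fact p.Prime] (n : ℕ)

/-- The matrix `(g_j, δ_ij; 0, 1)` over `ℤ_p[F]`, where `F` is the abstract free group. -/
def foxUnit (i j : Fin n) :
    (Matrix (Fin 2) (Fin 2) (MonoidAlgebra ℤ_[p] (FreeGroup (Fin n))))ˣ where
  val := !![MonoidAlgebra.of ℤ_[p] _ (FreeGroup.of j), if i = j then 1 else 0; 0, 1]
  inv := !![MonoidAlgebra.of ℤ_[p] _ (FreeGroup.of j)⁻¹,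
    if i = j then -MonoidAlgebra.of ℤ_[p] _ (FreeGroup.of j)⁻¹ else 0; 0, 1]
  val_inv := by
    rw [Matrix.mul_fin_two, Matrix.one_fin_two]
    congr 1
    split_ifs <;> simp [← map_mul, -MonoidAlgebra.of_apply]
  inv_val := by
    rw [Matrix.mul_fin_two, Matrix.one_fin_two]
    congr 1
    split_ifs <;> simp [← map_mul, -MonoidAlgebra.of_apply]

/-- The classical Fox derivative `∂w/∂g_i` of an element `w` of the abstract free group: the upper
right entry of the product of the matrices `foxUnit i j` along `w`. It is characterized by
`foxGroup_of` and `foxGroup_mul` below. -/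
def foxGroup (i : Fin n) (w : FreeGroup (Fin n)) : MonoidAlgebra ℤ_[p] (FreeGroup (Fin n)) :=
  (FreeGroup.lift (foxUnit p n i) w).1 0 1

theorem foxGroup_of (i j : Fin n) :
    foxGroup p n i (FreeGroup.of j) = if i = j then 1 else 0 := by
  simp [foxGroup, foxUnit]

theorem fox_lift_eq (i : Fin n) (w : FreeGroup (Fin n)) :
    (FreeGroup.lift (foxUnit p n i) w).1 =
      !![MonoidAlgebra.of ℤ_[p] _ w, foxGroup p n i w; 0, 1] := by
  have key : (FreeGroup.lift (foxUnit p n i) w).1 0 0 = MonoidAlgebra.of ℤ_[p] _ w ∧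
      (FreeGroup.lift (foxUnit p n i) w).1 1 0 = 0 ∧
      (FreeGroup.lift (foxUnit p n i) w).1 1 1 = 1 := by
    induction w using FreeGroup.induction_on with
    | C1 => simp [MonoidAlgebra.one_def]
    | of j => simp [foxUnit]
    | inv_of j _ => rw [map_inv, FreeGroup.lift_apply_of]; simp [foxUnit]
    | mul x y hx hy =>
      obtain ⟨h1, h2, h3⟩ := hx
      obtain ⟨k1, k2, k3⟩ := hy
      rw [map_mul, Units.val_mul]
      simp only [Matrix.mul_apply, Fin.sum_univ_two, h1, h2, h3, k1, k2, k3, map_mul]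
      simp
  obtain ⟨h1, h2, h3⟩ := key
  refine Matrix.ext fun a b => ?_
  fin_cases a <;> fin_cases b
  · exact h1
  · rfl
  · exact h2
  · exact h3

theorem foxGroup_mul (i : Fin n) (v w : FreeGroup (Fin n)) :
    foxGroup p n i (v * w) =
      foxGroup p n i v + MonoidAlgebra.of ℤ_[p] _ v * foxGroup p n i w := by
  have h : foxGroup p n i (v * w) = (FreeGroup.lift (foxUnit p n i) (v * w)).1 0 1 := rfl
  rw [h, map_mul, Units.val_mul, fox_lift_eq, fox_lift_eq, Matrix.mul_fin_two]
  simp [add_comm]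

/-- The canonical homomorphism from the group algebra `ℤ_p[F]` of the abstract free group to the
complete group algebra `ℤ_p[[F_n]]` of the free pro-`p` group; it has dense image. -/
def freeToCompleted :
    MonoidAlgebra ℤ_[p] (FreeGroup (Fin n)) →ₐ[ℤ_[p]] CompletedGroupAlgebra p (FreeProP p n) :=
  (CompletedGroupAlgebra.ofGroupAlgebra p (FreeProP p n)).comp
    (MonoidAlgebra.mapDomainAlgHom ℤ_[p] ℤ_[p] (FreeProP.ofFreeGroup p n))

/-- The pro-`p` Fox derivative `∂/∂g_i : ℤ_p[[F_n]] → ℤ_p[[F_n]]`: the extension by continuity of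
the `ℤ_p`-linear classical Fox derivative. -/
def foxDeriv (i : Fin n) (x : CompletedGroupAlgebra p (FreeProP p n)) :
    CompletedGroupAlgebra p (FreeProP p n) :=
  haveI : Nonempty (CompletedGroupAlgebra p (FreeProP p n)) := ⟨0⟩
  limUnder (comap (freeToCompleted p n) (𝓝 x))
    (fun z => freeToCompleted p n
      (Finsupp.linearCombination ℤ_[p] (foxGroup p n i) z.coeff))

end Fox

/-! ### The ring `ℚ̄_p ⊗ ℤ_p[[H]]`, twisted representations and Fitting ideals -/

section Twist

variable (p : ℕ) [Fact p.Prime]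

/-- The ring `ℚ̄_p ⊗_{ℤ_p} ℤ_p[[H]]`. -/
abbrev ExtCompletedGroupAlgebra (H : Type*) [CommGroup H] [TopologicalSpace H] : Type _ :=
  PadicAlgCl p ⊗[ℤ_[p]] CompletedGroupAlgebra p H

/-- The coefficient of an element of `ℚ̄_p ⊗ ℤ_p[[H]]` at a coset of an open subgroup of `H`. -/
def extCoeffAt (H : Type*) [CommGroup H] [TopologicalSpace H] (U : OpenNormalSubgroup H)
    (c : H ⧸ (U : Subgroup H)) : ExtCompletedGroupAlgebra p H →ₗ[PadicAlgCl p] PadicAlgCl p :=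
  LinearMap.liftBaseChange (PadicAlgCl p)
    ((Algebra.linearMap ℤ_[p] (PadicAlgCl p)).comp (CompletedGroupAlgebra.coeffAt p H U c))

/-- The topology on `ℚ̄_p ⊗ ℤ_p[[H]]` for which all coefficients are continuous, that is, the
topology induced by the embedding into the inverse limit of the group algebras `ℚ̄_p[H/U]`. -/
instance (H : Type*) [CommGroup H] [TopologicalSpace H] :
    TopologicalSpace (ExtCompletedGroupAlgebra p H) :=
  TopologicalSpace.induced
    (fun y (q : Σ U : OpenNormalSubgroup H, H ⧸ (U : Subgroup H)) => extCoeffAt p H q.1 q.2 y)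
    inferInstance

variable {p} {F H : Type*} [Group F] [TopologicalSpace F] [CommGroup H] [TopologicalSpace H]
  {ℓ : ℕ}

/-- The tensor product representation `φ̃ = φ ⊗ ψ`, `x ↦ φ(x) · ψ(x)`, with values in
`GL(ℓ; ℚ̄_p ⊗ ℤ_p[[H]])`. -/
def tensorRep (φ : F →ₜ* GL (Fin ℓ) (PadicAlgCl p)) (ψ : F →ₜ* H) :
    F →* GL (Fin ℓ) (ExtCompletedGroupAlgebra p H) :=
  MonoidHom.toHomUnits
    { toFun := fun x => ((φ x : Matrix (Fin ℓ) (Fin ℓ) (PadicAlgCl p))).map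
        fun c => c ⊗ₜ[ℤ_[p]] CompletedGroupAlgebra.of p H (ψ x)
      map_one' := by
        ext i j
        by_cases h : i = j <;>
          simp [Matrix.one_apply, h, Algebra.TensorProduct.one_def]
      map_mul' := by
        intro x y
        ext i j
        simp [Matrix.mul_apply, TensorProduct.sum_tmul] }

/-- The continuous `ℤ_p`-linear extension of `φ̃ = φ ⊗ ψ` to the complete group algebra
`ℤ_p[[F]]`. -/
def tensorRepCompleted (φ : F →ₜ* GL (Fin ℓ) (PadicAlgCl p)) (ψ : F →ₜ* H) :
    CompletedGroupAlgebra p F → Matrix (Fin ℓ) (Fin ℓ) (ExtCompletedGroupAlgebra p H) :=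
  CompletedGroupAlgebra.extend p F
    (fun x => (tensorRep φ ψ x : Matrix (Fin ℓ) (Fin ℓ) (ExtCompletedGroupAlgebra p H)))

/-- The `mℓ × nℓ` matrix `Q_φ̃ = (φ̃(∂r_j/∂g_i))`; its block in position `(j, i)` is the
`ℓ × ℓ` matrix `φ̃(∂r_j/∂g_i)`. -/
def foxMatrix {n m : ℕ} (r : Fin m → FreeProP p n) (φ : FreeProP p n →ₜ* GL (Fin ℓ) (PadicAlgCl p))
    (ψ : FreeProP p n →ₜ* H) :
    Matrix (Fin m × Fin ℓ) (Fin n × Fin ℓ) (ExtCompletedGroupAlgebra p H) :=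
  Matrix.of fun s t =>
    tensorRepCompleted φ ψ
      (foxDeriv p n t.1 (CompletedGroupAlgebra.of p (FreeProP p n) (r s.1))) s.2 t.2

/-- The set of minors of size `s` of a matrix (up to sign). -/
def minors {ι κ R : Type*} [CommRing R] (Q : Matrix ι κ R) (s : ℕ) : Set R :=
  {x | ∃ (f : Fin s ↪ ι) (g : Fin s ↪ κ), x = (Q.submatrix f g).det}

/-- The `d`-th Fitting ideal `E_d(A_φ̃)`, generated by the minors of size `nℓ - d` of `Q_φ̃`. It is
zero if `nℓ - d > mℓ`, since there are no such minors then. -/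
def fittingIdeal {n m : ℕ} (r : Fin m → FreeProP p n)
    (φ : FreeProP p n →ₜ* GL (Fin ℓ) (PadicAlgCl p)) (ψ : FreeProP p n →ₜ* H) (d : ℕ) :
    Ideal (ExtCompletedGroupAlgebra p H) :=
  Ideal.span (minors (foxMatrix r φ ψ) (n * ℓ - d))

/-- `g` is a greatest common divisor of the elements of the ideal `I` (equivalently, of any set of
generators of `I`). -/
structure IsIdealGCD {R : Type*} [CommRing R] (I : Ideal R) (g : R) : Prop where
  dvd : ∀ f ∈ I, g ∣ f
  dvd_of_dvd : ∀ d : R, (∀ f ∈ I, d ∣ f) → d ∣ g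

/-- `Δ` is (a representative, up to units, of) `Δ_d(A_φ̃)`, the greatest common divisor of the
generators of `E_d(A_φ̃)`. -/
def IsTwistedAlexander {n m : ℕ} (r : Fin m → FreeProP p n)
    (φ : FreeProP p n →ₜ* GL (Fin ℓ) (PadicAlgCl p)) (ψ : FreeProP p n →ₜ* H) (d : ℕ)
    (Δ : ExtCompletedGroupAlgebra p H) : Prop :=
  IsIdealGCD (fittingIdeal r φ ψ d) Δ

end Twist

/-! ### First continuous cohomology -/

section Cohomology

variable {p : ℕ} [Fact p.Prime] {G : Type*} [Group G] [TopologicalSpace G] {ℓ : ℕ}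

/-- Continuous 1-cocycles `β : G → (ℚ̄_p^ℓ)_ρ`. -/
def oneCocycles (ρ : G →ₜ* GL (Fin ℓ) (PadicAlgCl p)) :
    Submodule (PadicAlgCl p) (G → Fin ℓ → PadicAlgCl p) where
  carrier := {β | Continuous β ∧ ∀ x y, β (x * y) =
    β x + Matrix.mulVec (ρ x : Matrix (Fin ℓ) (Fin ℓ) (PadicAlgCl p)) (β y)}
  add_mem' := by
    rintro β β' ⟨h1, h2⟩ ⟨k1, k2⟩
    refine ⟨h1.add k1, fun x y => ?_⟩
    simp only [Pi.add_apply, h2, k2, Matrix.mulVec_add]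
    abel
  zero_mem' := ⟨continuous_const, fun x y => by simp⟩
  smul_mem' := by
    rintro c β ⟨h1, h2⟩
    refine ⟨h1.const_smul c, fun x y => ?_⟩
    simp only [Pi.smul_apply, h2, smul_add, Matrix.mulVec_smul]

/-- The map sending a vector `v` to the function `x ↦ ρ(x) v - v`. -/
def coboundaryMap (ρ : G →ₜ* GL (Fin ℓ) (PadicAlgCl p)) :
    (Fin ℓ → PadicAlgCl p) →ₗ[PadicAlgCl p] (G → Fin ℓ → PadicAlgCl p) where
  toFun v x := Matrix.mulVec (ρ x : Matrix (Fin ℓ) (Fin ℓ) (PadicAlgCl p)) v - v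
  map_add' v w := by
    funext x
    simp only [Pi.add_apply, Matrix.mulVec_add]
    abel
  map_smul' c v := by
    funext x
    simp only [Pi.smul_apply, Matrix.mulVec_smul, RingHom.id_apply, smul_sub]

/-- 1-coboundaries `x ↦ ρ(x) v - v`. -/
def oneCoboundaries (ρ : G →ₜ* GL (Fin ℓ) (PadicAlgCl p)) :
    Submodule (PadicAlgCl p) (G → Fin ℓ → PadicAlgCl p) :=
  LinearMap.range (coboundaryMap ρ)

theorem oneCoboundaries_le (ρ : G →ₜ* GL (Fin ℓ) (PadicAlgCl p)) :
    oneCoboundaries ρ ≤ oneCocycles ρ := by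
  rintro _ ⟨v, rfl⟩
  refine ⟨?_, fun x y => ?_⟩
  · have h : Continuous fun x => (ρ x : Matrix (Fin ℓ) (Fin ℓ) (PadicAlgCl p)) :=
      Units.continuous_val.comp ρ.continuous_toFun
    exact (h.matrix_mulVec continuous_const).sub continuous_const
  · simp only [coboundaryMap, LinearMap.coe_mk, AddHom.coe_mk, map_mul, Units.val_mul,
      Matrix.mulVec_sub, Matrix.mulVec_mulVec]
    abel

/-- The first continuous cohomology group `H¹(G, (ℚ̄_p^ℓ)_ρ) = Z¹ / B¹`. -/
abbrev ContH1 (ρ : G →ₜ* GL (Fin ℓ) (PadicAlgCl p)) : Type _ :=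
  oneCocycles ρ ⧸ (oneCoboundaries ρ).submoduleOf (oneCocycles ρ)

end Cohomology

/-! ### The specialization `γ = a` -/

section Evaluation

variable (p : ℕ) [Fact p.Prime]

/-- The group `Γ = ℤ_p`, written multiplicatively. -/
abbrev Gam : Type := Multiplicative ℤ_[p]

/-- The open subgroup `p^N ℤ_p` of `Γ`. -/
def gamLevel (N : ℕ) : OpenNormalSubgroup (Gam p) where
  carrier := {x | (p : ℤ_[p]) ^ N ∣ x.toAdd}
  mul_mem' := fun hx hy => dvd_add hx hy
  one_mem' := dvd_zero _
  inv_mem' := fun hx => (dvd_neg).2 hx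
  isOpen' := by
    have h : {x : Gam p | (p : ℤ_[p]) ^ N ∣ x.toAdd} =
        Multiplicative.toAdd ⁻¹' Metric.closedBall (0 : ℤ_[p]) ((p : ℝ) ^ (-N : ℤ)) := by
      ext x
      rw [Set.mem_preimage, mem_closedBall_zero_iff, PadicInt.norm_le_pow_iff_mem_span_pow,
        Ideal.mem_span_singleton, Set.mem_ofPred_eq]
    have hp : (p : ℝ) ^ (-N : ℤ) ≠ 0 :=
      zpow_ne_zero _ (Nat.cast_ne_zero.2 (Fact.out : p.Prime).ne_zero)
    change IsOpen {x : Gam p | (p : ℤ_[p]) ^ N ∣ x.toAdd}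
    rw [h]
    exact (IsUltrametricDist.isOpen_closedBall (0 : ℤ_[p]) hp).preimage continuous_toAdd
  isNormal' := inferInstance

variable {p}

theorem mem_gamLevel {N : ℕ} {x : Gam p} : x ∈ (gamLevel p N : Subgroup (Gam p)) ↔
    (p : ℤ_[p]) ^ N ∣ x.toAdd := Iff.rfl

theorem gamLevel_anti (N : ℕ) : gamLevel p (N + 1) ≤ gamLevel p N :=
  fun _ hx => (pow_dvd_pow _ (Nat.le_succ N)).trans hx

/-- The value at `a` of the polynomial in `γ` of degree less than `p^N` that represents an element
of `ℤ_p[[Γ]]` modulo `γ^(p^N) - 1`, that is, its image `∑_j c_j γ^j` in `ℤ_p[Γ/Γ^(p^N)]`. -/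
def evalStep (γ : Gam p) (a : PadicAlgCl p) (N : ℕ) :
    CompletedGroupAlgebra p (Gam p) →ₗ[ℤ_[p]] PadicAlgCl p :=
  ∑ j ∈ Finset.range (p ^ N), LinearMap.smulRight
    (CompletedGroupAlgebra.coeffAt p (Gam p) (gamLevel p N) (QuotientGroup.mk (γ ^ j))) (a ^ j)

theorem evalStep_apply (γ : Gam p) (a : PadicAlgCl p) (N : ℕ)
    (x : CompletedGroupAlgebra p (Gam p)) :
    evalStep γ a N x = ∑ j ∈ Finset.range (p ^ N),
      (CompletedGroupAlgebra.coeffAt p (Gam p) (gamLevel p N) (QuotientGroup.mk (γ ^ j)) x) •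
        a ^ j := by
  simp [evalStep]

theorem gam_isUnit {γ : Gam p} (hγ : Dense (Subgroup.zpowers γ : Set (Gam p))) :
    IsUnit (Multiplicative.toAdd γ) := by
  by_contra h
  have hdvd : (p : ℤ_[p]) ∣ γ.toAdd := by
    rwa [← PadicInt.norm_lt_one_iff_dvd, PadicInt.norm_lt_one_iff_dvd,
      ← Ideal.mem_span_singleton, ← PadicInt.maximalIdeal_eq_span_p,
      IsLocalRing.mem_maximalIdeal, mem_nonunits_iff]
  have hsub : (Subgroup.zpowers γ : Set (Gam p)) ⊆ (gamLevel p 1 : Subgroup (Gam p)) := by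
    have : Subgroup.zpowers γ ≤ (gamLevel p 1 : Subgroup (Gam p)) := by
      rw [Subgroup.zpowers_le, mem_gamLevel, pow_one]
      exact hdvd
    exact this
  have hcl : IsClosed ((gamLevel p 1 : Subgroup (Gam p)) : Set (Gam p)) :=
    (gamLevel p 1 : Subgroup (Gam p)).isClosed_of_isOpen (gamLevel p 1).isOpen'
  have h1 : Multiplicative.ofAdd (1 : ℤ_[p]) ∈ (gamLevel p 1 : Subgroup (Gam p)) :=
    hcl.closure_subset_iff.2 hsub (hγ _)
  rw [mem_gamLevel, pow_one] at h1
  exact PadicInt.prime_p.not_isUnit (isUnit_of_dvd_one h1)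

theorem gam_mk_eq_iff {γ : Gam p} (hγ : Dense (Subgroup.zpowers γ : Set (Gam p))) (N i j : ℕ) :
    (QuotientGroup.mk (γ ^ i) : Gam p ⧸ (gamLevel p N : Subgroup (Gam p))) =
      QuotientGroup.mk (γ ^ j) ↔ i % p ^ N = j % p ^ N := by
  rw [QuotientGroup.eq, mem_gamLevel, toAdd_mul, toAdd_inv, toAdd_pow, toAdd_pow]
  have h : -(i • γ.toAdd) + j • γ.toAdd = ((j : ℤ_[p]) - i) * γ.toAdd := by
    simp only [nsmul_eq_mul]
    ring
  rw [h, (gam_isUnit hγ).dvd_mul_right]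
  have h2 : ((j : ℤ_[p]) - i) = (((j : ℤ) - i : ℤ) : ℤ_[p]) := by push_cast; rfl
  rw [h2, PadicInt.pow_p_dvd_int_iff]
  have h3 : ((p : ℤ) ^ N) = ((p ^ N : ℕ) : ℤ) := by push_cast; rfl
  rw [h3, ← Nat.modEq_iff_dvd]
  rfl

theorem gam_exists_pow {γ : Gam p} (hγ : Dense (Subgroup.zpowers γ : Set (Gam p))) (N : ℕ)
    (c : Gam p ⧸ (gamLevel p N : Subgroup (Gam p))) :
    ∃ j ∈ Finset.range (p ^ N), QuotientGroup.mk (γ ^ j) = c := by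
  obtain ⟨y, rfl⟩ := QuotientGroup.mk_surjective c
  have hpos : 0 < p ^ N := pow_pos (Fact.out : p.Prime).pos N
  have hopen : IsOpen {x : Gam p | y⁻¹ * x ∈ (gamLevel p N : Subgroup (Gam p))} :=
    (gamLevel p N).isOpen'.preimage (continuous_const.mul continuous_id)
  obtain ⟨_, ⟨z, rfl⟩, hx⟩ := hγ.exists_mem_open hopen ⟨y, by simp⟩
  have hzpos : 0 ≤ z % (p ^ N : ℕ) := Int.emod_nonneg _ (by exact_mod_cast hpos.ne')
  refine ⟨(z % (p ^ N : ℕ)).toNat, ?_, ?_⟩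
  · rw [Finset.mem_range]
    have := Int.emod_lt_of_pos z (by exact_mod_cast hpos : (0 : ℤ) < (p ^ N : ℕ))
    omega
  · symm
    rw [QuotientGroup.eq]
    have hmem : γ ^ (-((p ^ N : ℕ) * (z / (p ^ N : ℕ)) : ℤ)) ∈
        (gamLevel p N : Subgroup (Gam p)) := by
      rw [zpow_neg, zpow_mul, zpow_natCast]
      refine Subgroup.inv_mem _ (Subgroup.zpow_mem _ ?_ _)
      rw [mem_gamLevel, toAdd_pow, nsmul_eq_mul]
      push_cast
      exact dvd_mul_right _ _
    have h := Subgroup.mul_mem _ hx hmem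
    have he : y⁻¹ * γ ^ z * γ ^ (-((p ^ N : ℕ) * (z / (p ^ N : ℕ)) : ℤ)) =
        y⁻¹ * γ ^ (z % (p ^ N : ℕ)).toNat := by
      rw [mul_assoc, ← zpow_add, ← zpow_natCast γ (z % (p ^ N : ℕ)).toNat, Int.toNat_of_nonneg hzpos,
        Int.emod_def]
      rfl
    rwa [← he]

/-- An element of `ℤ_p[Γ/Γ^(p^N)]` is the sum of its coefficients times the powers of `γ`. -/
theorem gam_level_eq_sum {γ : Gam p} (hγ : Dense (Subgroup.zpowers γ : Set (Gam p))) (N : ℕ)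
    (f : (Gam p ⧸ (gamLevel p N : Subgroup (Gam p))) →₀ ℤ_[p]) :
    f = ∑ j ∈ Finset.range (p ^ N),
      Finsupp.single (QuotientGroup.mk (γ ^ j)) (f (QuotientGroup.mk (γ ^ j))) := by
  classical
  ext c
  obtain ⟨i, hi, rfl⟩ := gam_exists_pow hγ N c
  rw [Finsupp.finsetSum_apply, Finset.sum_eq_single i]
  · simp
  · intro j hj hji
    rw [Finsupp.single_apply, if_neg]
    rw [gam_mk_eq_iff hγ, Nat.mod_eq_of_lt (Finset.mem_range.1 hi),
      Nat.mod_eq_of_lt (Finset.mem_range.1 hj)]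
    exact hji
  · exact fun h => absurd hi h

theorem evalStep_sub {γ : Gam p} (hγ : Dense (Subgroup.zpowers γ : Set (Gam p)))
    (a : PadicAlgCl p) (N : ℕ) (x : CompletedGroupAlgebra p (Gam p)) :
    evalStep γ a (N + 1) x - evalStep γ a N x = ∑ j ∈ Finset.range (p ^ (N + 1)),
      (CompletedGroupAlgebra.coeffAt p (Gam p) (gamLevel p (N + 1)) (QuotientGroup.mk (γ ^ j)) x) •
        (a ^ j - a ^ (j % p ^ N)) := by
  classical
  have hpos : 0 < p ^ N := pow_pos (Fact.out : p.Prime).pos N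
  have key : ∀ i ∈ Finset.range (p ^ N),
      CompletedGroupAlgebra.coeffAt p (Gam p) (gamLevel p N) (QuotientGroup.mk (γ ^ i)) x =
      ∑ j ∈ Finset.range (p ^ (N + 1)), if j % p ^ N = i then
        CompletedGroupAlgebra.coeffAt p (Gam p) (gamLevel p (N + 1))
          (QuotientGroup.mk (γ ^ j)) x else 0 := by
    intro i hi
    have hx := x.2 (gamLevel p (N + 1)) (gamLevel p N) (gamLevel_anti N)
    change (x.1 (gamLevel p N)).coeff _ = _
    rw [← hx]
    change Finsupp.mapDomain _ (x.1 (gamLevel p (N + 1))).coeff _ = _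
    rw [gam_level_eq_sum hγ (N + 1) (x.1 (gamLevel p (N + 1))).coeff, Finsupp.mapDomain_finsetSum,
      Finsupp.finsetSum_apply]
    refine Finset.sum_congr rfl fun j _ => ?_
    rw [Finsupp.mapDomain_single, Finsupp.single_apply]
    have h2 := gam_mk_eq_iff hγ N j i
    rw [Nat.mod_eq_of_lt (Finset.mem_range.1 hi)] at h2
    by_cases hji : j % p ^ N = i
    · rw [if_pos hji]
      exact if_pos (h2.2 hji)
    · rw [if_neg hji]
      exact if_neg fun h => hji (h2.1 h)
  simp only [smul_sub, Finset.sum_sub_distrib]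
  rw [evalStep_apply, evalStep_apply, sub_right_inj, Finset.sum_congr rfl fun i hi => by
    rw [key i hi, Finset.sum_smul], Finset.sum_comm]
  refine Finset.sum_congr rfl fun j _ => ?_
  rw [Finset.sum_eq_single (j % p ^ N)]
  · rw [if_pos rfl]
  · intro i _ hij
    rw [if_neg (Ne.symm hij), zero_smul]
  · intro h
    exact absurd (Finset.mem_range.2 (Nat.mod_lt _ hpos)) h

theorem norm_algebraMap_padicInt_le (x : ℤ_[p]) : ‖algebraMap ℤ_[p] (PadicAlgCl p) x‖ ≤ 1 := by
  rw [IsScalarTower.algebraMap_apply ℤ_[p] ℚ_[p] (PadicAlgCl p)]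
  simpa using PadicInt.norm_le_one x

theorem norm_pow_sub_one_le {b : PadicAlgCl p} (hb : ‖b - 1‖ ≤ 1) (j : ℕ) :
    ‖b‖ ≤ 1 ∧ ‖b ^ j - 1‖ ≤ ‖b - 1‖ := by
  have hb1 : ‖b‖ ≤ 1 := by
    have h := PadicAlgCl.isNonarchimedean p (b - 1) 1
    rw [sub_add_cancel, norm_one] at h
    exact h.trans (max_le hb le_rfl)
  refine ⟨hb1, ?_⟩
  induction j with
  | zero => simp
  | succ j ih =>
    have h := PadicAlgCl.isNonarchimedean p (b ^ j * (b - 1)) (b ^ j - 1)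
    have he : b ^ j * (b - 1) + (b ^ j - 1) = b ^ (j + 1) - 1 := by ring
    rw [he] at h
    refine h.trans (max_le ?_ ih)
    rw [norm_mul, norm_pow]
    exact mul_le_of_le_one_left (norm_nonneg _) (pow_le_one₀ (norm_nonneg _) hb1)

theorem padic_norm_sum_le_of_le {ι : Type*} (s : Finset ι) (f : ι → PadicAlgCl p) {C : ℝ} (hC : 0 ≤ C)
    (h : ∀ i ∈ s, ‖f i‖ ≤ C) : ‖∑ i ∈ s, f i‖ ≤ C := by
  classical
  induction s using Finset.induction_on with
  | empty => simpa using hC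
  | insert i s hi ih =>
    rw [Finset.sum_insert hi]
    exact (PadicAlgCl.isNonarchimedean p _ _).trans (max_le (h i (Finset.mem_insert_self _ _))
      (ih fun j hj => h j (Finset.mem_insert_of_mem hj)))

theorem norm_pow_prime_pow_sub_one_le {a : PadicAlgCl p} (ha : ‖a - 1‖ < 1) (N : ℕ) :
    ‖a ^ p ^ N - 1‖ ≤ max ‖a - 1‖ (p : ℝ)⁻¹ ^ N := by
  have hp1 : (p : ℝ)⁻¹ < 1 := inv_lt_one_of_one_lt₀ (by exact_mod_cast (Fact.out : p.Prime).one_lt)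
  have hnp : ‖(p : PadicAlgCl p)‖ = (p : ℝ)⁻¹ := by
    rw [← map_natCast (algebraMap ℚ_[p] (PadicAlgCl p)), PadicAlgCl.norm_extends, Padic.norm_p]
  induction N with
  | zero => simpa using ha.le
  | succ N ih =>
    set b := a ^ p ^ N with hbdef
    have hba : ‖b - 1‖ ≤ ‖a - 1‖ := (norm_pow_sub_one_le ha.le _).2
    have hb1 : ‖b - 1‖ ≤ 1 := hba.trans ha.le
    have hfac : a ^ p ^ (N + 1) - 1 = (∑ i ∈ Finset.range p, b ^ i) * (b - 1) := by
      rw [geom_sum_mul, hbdef, ← pow_mul, ← pow_succ]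
    have hsum : ‖∑ i ∈ Finset.range p, b ^ i‖ ≤ max ‖a - 1‖ (p : ℝ)⁻¹ := by
      have he : ∑ i ∈ Finset.range p, b ^ i =
          ∑ i ∈ Finset.range p, (b ^ i - 1) + (p : PadicAlgCl p) := by
        simp [Finset.sum_sub_distrib]
      rw [he]
      refine (PadicAlgCl.isNonarchimedean p _ _).trans (max_le_max ?_ hnp.le)
      exact padic_norm_sum_le_of_le _ _ (norm_nonneg _)
        fun i _ => ((norm_pow_sub_one_le hb1 i).2).trans hba
    rw [hfac, norm_mul, pow_succ']
    exact mul_le_mul hsum ih (norm_nonneg _) (le_max_of_le_left (norm_nonneg _))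

theorem norm_evalStep_sub_le {γ : Gam p} (hγ : Dense (Subgroup.zpowers γ : Set (Gam p)))
    {a : PadicAlgCl p} (ha : ‖a - 1‖ < 1) (N : ℕ) (x : CompletedGroupAlgebra p (Gam p)) :
    ‖evalStep γ a (N + 1) x - evalStep γ a N x‖ ≤ max ‖a - 1‖ (p : ℝ)⁻¹ ^ N := by
  rw [evalStep_sub hγ]
  refine padic_norm_sum_le_of_le _ _ (pow_nonneg (le_max_of_le_left (norm_nonneg _)) _) fun j _ => ?_
  have hN := norm_pow_prime_pow_sub_one_le ha N
  have hb1 : ‖a ^ p ^ N - 1‖ ≤ 1 := ((norm_pow_sub_one_le ha.le _).2).trans ha.le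
  have he : a ^ j - a ^ (j % p ^ N) = a ^ (j % p ^ N) * ((a ^ p ^ N) ^ (j / p ^ N) - 1) := by
    rw [mul_sub, mul_one, ← pow_mul, ← pow_add, Nat.mod_add_div]
  rw [he, Algebra.smul_def, norm_mul, norm_mul, norm_pow]
  refine (mul_le_of_le_one_left (by positivity) (norm_algebraMap_padicInt_le _)).trans ?_
  refine (mul_le_of_le_one_left (norm_nonneg _)
    (pow_le_one₀ (norm_nonneg _) (norm_pow_sub_one_le ha.le 0).1)).trans ?_
  exact ((norm_pow_sub_one_le hb1 _).2).trans hN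

theorem exists_tendsto_evalStep {γ : Gam p} (hγ : Dense (Subgroup.zpowers γ : Set (Gam p)))
    {a : PadicAlgCl p} (ha : ‖a - 1‖ < 1) (x : CompletedGroupAlgebra p (Gam p)) :
    ∃ y, Tendsto (fun N => evalStep γ a N x) atTop (𝓝 y) := by
  let E := IntermediateField.adjoin ℚ_[p] {a}
  have hE : FiniteDimensional ℚ_[p] E :=
    IntermediateField.adjoin.finiteDimensional (Algebra.IsIntegral.isIntegral a)
  have hc : CompleteSpace E := FiniteDimensional.complete ℚ_[p] E
  have hmem : ∀ N, evalStep γ a N x ∈ E := by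
    intro N
    rw [evalStep_apply]
    refine sum_mem fun j _ => ?_
    rw [Algebra.smul_def, IsScalarTower.algebraMap_apply ℤ_[p] ℚ_[p] (PadicAlgCl p)]
    exact mul_mem (E.algebraMap_mem _)
      (pow_mem (IntermediateField.mem_adjoin_simple_self ℚ_[p] a) j)
  have hC1 : max ‖a - 1‖ (p : ℝ)⁻¹ < 1 :=
    max_lt ha (inv_lt_one_of_one_lt₀ (by exact_mod_cast (Fact.out : p.Prime).one_lt))
  have hcau : CauchySeq (fun N => (⟨evalStep γ a N x, hmem N⟩ : E)) := by
    refine cauchySeq_of_le_geometric _ 1 hC1 fun N => ?_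
    rw [one_mul, dist_comm, dist_eq_norm]
    exact norm_evalStep_sub_le hγ ha N x
  obtain ⟨y, hy⟩ := cauchySeq_tendsto_of_complete hcau
  exact ⟨y, (continuous_subtype_val.tendsto y).comp hy⟩

/-- The specialization `γ = a` on `ℤ_p[[Γ]]`, where `γ` is a topological generator of `Γ` and
`|a - 1|_p < 1`: reduce modulo `γ^(p^N) - 1` to a polynomial in `γ`, substitute `a` for `γ`, and let
`N` tend to infinity. -/
def evalCompleted (γ : Gam p) (hγ : Dense (Subgroup.zpowers γ : Set (Gam p)))
    (a : PadicAlgCl p) (ha : ‖a - 1‖ < 1) :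
    CompletedGroupAlgebra p (Gam p) →ₗ[ℤ_[p]] PadicAlgCl p where
  toFun x := limUnder atTop fun N => evalStep γ a N x
  map_add' x y := by
    have hx := tendsto_nhds_limUnder (exists_tendsto_evalStep hγ ha x)
    have hy := tendsto_nhds_limUnder (exists_tendsto_evalStep hγ ha y)
    refine Tendsto.limUnder_eq ?_
    simpa only [map_add] using hx.add hy
  map_smul' c x := by
    have hx := tendsto_nhds_limUnder (exists_tendsto_evalStep hγ ha x)
    have hc : ∀ N, evalStep γ a N (c • x) = algebraMap ℤ_[p] (PadicAlgCl p) c * evalStep γ a N x :=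
      fun N => by rw [map_smul, Algebra.smul_def]
    refine Tendsto.limUnder_eq ?_
    simp only [hc, RingHom.id_apply]
    rw [Algebra.smul_def]
    exact hx.const_mul _

/-- The specialization `γ = a` on `ℚ̄_p ⊗ ℤ_p[[Γ]]`, extended `ℚ̄_p`-linearly. -/
def evalAt (γ : Gam p) (hγ : Dense (Subgroup.zpowers γ : Set (Gam p)))
    (a : PadicAlgCl p) (ha : ‖a - 1‖ < 1) :
    ExtCompletedGroupAlgebra p (Gam p) →ₗ[PadicAlgCl p] PadicAlgCl p :=
  LinearMap.liftBaseChange (PadicAlgCl p) (evalCompleted γ hγ a ha)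

end Evaluation

end

open Filter Topology TensorProduct

noncomputable section

/-! ### Congruences modulo powers of `p` in `ℤ_p` -/

namespace PadicInt

variable {p : ℕ} [Fact p.Prime]

/-! Put `ℓ = k - 1` and let `Q(a)` be the Fox matrix specialized at `γ = a`. A continuous cocycle is
determined by its values at the generators, and Fox's fundamental formula, applied to the relators,
shows that these values form a vector killed by `Q(a)`. So `Z¹` embeds in `ker Q(a)`. Without
invariants `B¹` has dimension `ℓ`, and `H¹ ≠ 0` forces `dim Z¹ > ℓ`, whence `rank Q(a) < nℓ - ℓ`
(`rank_foxMatrix_lt`). All minors of size `nℓ - ℓ` therefore vanish at `a`. Since `ℚ̄_p ⊗ ℤ_p[[Γ]]`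
is a principal ideal ring, their gcd exists and lies in the ideal they generate, so it vanishes at
`a` too. If there are no such minors, the ideal is zero and so is the gcd.

Two things need work. The first is analytic: Fox derivatives and the extension of `φ̃` are defined
by `limUnder`, so these limits must be shown to exist, and the specialization must be a ring
homomorphism compatible with them. Modulo an open subgroup and `p^s`, the Fox derivative is a matrix
entry of a homomorphism to a finite group with `p`-group image (`exists_ker_foxHom_eq`), hence
uniformly continuous on words. The entries of `φ` lie in a finite extension of `ℚ_p` and are
bounded, so each entry of `φ̃` is a fixed finite combination of `ℤ_p[[Γ]]`-valued functions, and
compactness of `ℤ_p[[Γ]]` supplies limits.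

The second is algebraic: `ℤ_p[[T]]` surjects onto `ℤ_p[[Γ]]`, and ideals of `ℚ̄_p ⊗ ℤ_p[[T]]` are
principal because Weierstrass preparation and division reduce them to ideals of `ℚ̄_p[T]`. -/

theorem isClopen_setOf_pow_dvd_sub (s : ℕ) (y : ℤ_[p]) :
    IsClopen {x : ℤ_[p] | (p : ℤ_[p]) ^ s ∣ x - y} := by
  have h : {x : ℤ_[p] | (p : ℤ_[p]) ^ s ∣ x - y} = Metric.closedBall y ((p : ℝ) ^ (-s : ℤ)) := by
    ext x
    rw [mem_closedBall_iff_norm, PadicInt.norm_le_pow_iff_mem_span_pow, Ideal.mem_span_singleton,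
      Set.mem_ofPred_eq]
  have hp : (p : ℝ) ^ (-s : ℤ) ≠ 0 :=
    zpow_ne_zero _ (Nat.cast_ne_zero.2 (Fact.out : p.Prime).ne_zero)
  rw [h]
  exact IsUltrametricDist.isClopen_closedBall y hp

theorem tendsto_nhds_of_pow_dvd_sub {ι : Type*} {l : Filter ι} {f : ι → ℤ_[p]} {y : ℤ_[p]}
    (h : ∀ s : ℕ, ∀ᶠ i in l, (p : ℤ_[p]) ^ s ∣ f i - y) : Tendsto f l (𝓝 y) := by
  rw [Metric.tendsto_nhds]
  intro ε hε
  obtain ⟨s, hs⟩ := exists_pow_lt_of_lt_one hε (inv_lt_one_of_one_lt₀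
    (by exact_mod_cast (Fact.out : p.Prime).one_lt : (1 : ℝ) < p))
  filter_upwards [h s] with i hi
  rw [dist_eq_norm]
  rw [← Ideal.mem_span_singleton, ← PadicInt.norm_le_pow_iff_mem_span_pow] at hi
  refine hi.trans_lt ?_
  simpa using hs

end PadicInt

/-! ### Compactness, density and extension by continuity for `ℤ_p[[G]]` -/

namespace CompletedGroupAlgebra

variable {p : ℕ} [Fact p.Prime] {G : Type*} [Group G] [TopologicalSpace G]

variable (p G) in
/-- The family of all coefficients of an element of `ℤ_p[[G]]`. -/
def coeffs (x : CompletedGroupAlgebra p G) (q : Σ U : OpenNormalSubgroup G, G ⧸ (U : Subgroup G)) :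
    ℤ_[p] :=
  coeffAt p G q.1 q.2 x

theorem isInducing_coeffs : IsInducing (coeffs p G) := ⟨rfl⟩

theorem ext_coeffAt {x y : CompletedGroupAlgebra p G}
    (h : ∀ U c, coeffAt p G U c x = coeffAt p G U c y) : x = y :=
  ext_proj fun U => MonoidAlgebra.ext (Finsupp.ext fun c => h U c)

theorem coeffs_injective : Function.Injective (coeffs p G) :=
  fun _ _ h => ext_coeffAt fun U c => congrFun h ⟨U, c⟩

instance : T2Space (CompletedGroupAlgebra p G) :=
  (IsEmbedding.mk isInducing_coeffs coeffs_injective).t2Space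

theorem continuous_coeffAt (U : OpenNormalSubgroup G) (c : G ⧸ (U : Subgroup G)) :
    Continuous (coeffAt p G U c) :=
  (continuous_apply (⟨U, c⟩ : Σ U : OpenNormalSubgroup G, G ⧸ (U : Subgroup G))).comp
    isInducing_coeffs.continuous

theorem tendsto_nhds_iff_coeffAt {ι : Type*} {l : Filter ι} {f : ι → CompletedGroupAlgebra p G}
    {y : CompletedGroupAlgebra p G} : Tendsto f l (𝓝 y) ↔
      ∀ U c, Tendsto (fun i => coeffAt p G U c (f i)) l (𝓝 (coeffAt p G U c y)) := by
  rw [isInducing_coeffs.tendsto_nhds_iff, tendsto_pi_nhds]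
  exact ⟨fun h U c => h ⟨U, c⟩, fun h q => h q.1 q.2⟩

theorem coeff_levelMap {U V : OpenNormalSubgroup G} [Fintype (G ⧸ (U : Subgroup G))]
    [DecidableEq (G ⧸ (V : Subgroup G))]
    (h : U ≤ V) (x : MonoidAlgebra ℤ_[p] (G ⧸ (U : Subgroup G))) (c : G ⧸ (V : Subgroup G)) :
    (levelMap p G h x).coeff c = ∑ d : G ⧸ (U : Subgroup G),
      if QuotientGroup.map (U : Subgroup G) (V : Subgroup G) (MonoidHom.id G) (fun _ hg => h hg) d = c
        then x.coeff d else 0 := by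
  classical
  change Finsupp.mapDomain _ x.coeff c = _
  conv_lhs => rw [← Finsupp.univ_sum_single x.coeff]
  rw [Finsupp.mapDomain_finsetSum, Finsupp.finsetSum_apply]
  refine Finset.sum_congr rfl fun d _ => ?_
  rw [Finsupp.mapDomain_single, Finsupp.single_apply]

/-- The coefficients embed the algebra in a product of copies of `ℤ_p`. As the quotients are finite,
compatibility is a system of finite linear equations between coordinates, so the image is closed. -/
instance compactSpace [∀ U : OpenNormalSubgroup G, Finite (G ⧸ (U : Subgroup G))] :
    CompactSpace (CompletedGroupAlgebra p G) := by
  classical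
  have (U : OpenNormalSubgroup G) : Fintype (G ⧸ (U : Subgroup G)) := Fintype.ofFinite _
  refine IsClosedEmbedding.compactSpace (f := coeffs p G)
    ⟨⟨isInducing_coeffs, coeffs_injective⟩, ?_⟩
  have h : Set.range (coeffs p G) = ⋂ (U : OpenNormalSubgroup G) (V : OpenNormalSubgroup G)
      (h : U ≤ V) (c : G ⧸ (V : Subgroup G)),
      {y | y ⟨V, c⟩ = ∑ d : G ⧸ (U : Subgroup G),
        if QuotientGroup.map (U : Subgroup G) (V : Subgroup G) (MonoidHom.id G)
          (fun _ hg => h hg) d = c then y ⟨U, d⟩ else 0} := by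
    ext y
    simp only [Set.mem_iInter, Set.mem_range, Set.mem_ofPred_eq]
    constructor
    · rintro ⟨x, rfl⟩ U V h c
      change (x.1 V).coeff c = _
      rw [← x.2 U V h, coeff_levelMap]
      rfl
    · intro hy
      refine ⟨⟨fun U => MonoidAlgebra.ofCoeff (Finsupp.equivFunOnFinite.symm fun c => y ⟨U, c⟩),
        fun U V h => MonoidAlgebra.ext (Finsupp.ext fun c => ?_)⟩, rfl⟩
      rw [coeff_levelMap]
      exact (hy U V h c).symm
  rw [h]
  refine isClosed_iInter fun U => isClosed_iInter fun V => isClosed_iInter fun h =>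
    isClosed_iInter fun c => isClosed_eq (continuous_apply _) (continuous_finsetSum _ fun d _ => ?_)
  split_ifs
  · exact continuous_apply _
  · exact continuous_const

/-- The homomorphism `ℤ_p[A] → ℤ_p[[G]]` induced by a homomorphism `A → G`. -/
def ofHom {A : Type*} [Group A] (j : A →* G) :
    MonoidAlgebra ℤ_[p] A →ₐ[ℤ_[p]] CompletedGroupAlgebra p G :=
  (ofGroupAlgebra p G).comp (MonoidAlgebra.mapDomainAlgHom ℤ_[p] ℤ_[p] j)

theorem ofHom_id : ofHom (MonoidHom.id G) = ofGroupAlgebra p G := by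
  rw [ofHom, MonoidAlgebra.mapDomainAlgHom_id, AlgHom.comp_id]

theorem coeffAt_linearCombination {A H : Type*} [Group H] [TopologicalSpace H]
    (V : OpenNormalSubgroup H) (c : H ⧸ (V : Subgroup H)) (f : A → CompletedGroupAlgebra p H)
    (z : A →₀ ℤ_[p]) : coeffAt p H V c (Finsupp.linearCombination ℤ_[p] f z) =
      Finsupp.linearCombination ℤ_[p] (fun a => coeffAt p H V c (f a)) z := by
  rw [Finsupp.apply_linearCombination]
  rfl

section

variable {A : Type*} [Group A] (j : A →* G)

theorem coeffAt_ofHom (U : OpenNormalSubgroup G) (c : G ⧸ (U : Subgroup G))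
    (z : MonoidAlgebra ℤ_[p] A) : coeffAt p G U c (ofHom j z) =
      Finsupp.mapDomain (fun a => (QuotientGroup.mk (j a) : G ⧸ (U : Subgroup G))) z.coeff c := by
  change Finsupp.mapDomain _ (Finsupp.mapDomain _ z.coeff) c = _
  rw [← Finsupp.mapDomain_comp]
  rfl


/-- Modulo `p^s` the function `g` factors through `G/U`, so its linear extension only sees the image
of `z` in `(ℤ/p^s)[G/U]`, which is zero. -/
theorem pow_dvd_linearCombination {U : OpenNormalSubgroup G} {s : ℕ} {g : A → ℤ_[p]}
    (hg : ∀ a b, (QuotientGroup.mk (j a) : G ⧸ (U : Subgroup G)) = QuotientGroup.mk (j b) →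
      (p : ℤ_[p]) ^ s ∣ g a - g b)
    {z : MonoidAlgebra ℤ_[p] A} (hz : ∀ c, (p : ℤ_[p]) ^ s ∣ coeffAt p G U c (ofHom j z)) :
    (p : ℤ_[p]) ^ s ∣ Finsupp.linearCombination ℤ_[p] g z.coeff := by
  classical
  let q : A → G ⧸ (U : Subgroup G) := fun a => QuotientGroup.mk (j a)
  -- The value `0` on cosets missed by `j` is arbitrary, since `hz` covers every coset.
  let rep : G ⧸ (U : Subgroup G) → ℤ_[p] := fun c => if h : ∃ a, q a = c then g h.choose else 0
  have hrep : ∀ a, (p : ℤ_[p]) ^ s ∣ g a - rep (q a) := by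
    intro a
    have h : ∃ b, q b = q a := ⟨a, rfl⟩
    simp only [rep, dif_pos h]
    exact hg _ _ h.choose_spec.symm
  have he : Finsupp.linearCombination ℤ_[p] g z.coeff =
      Finsupp.linearCombination ℤ_[p] rep (Finsupp.mapDomain q z.coeff) +
        Finsupp.linearCombination ℤ_[p] (fun a => g a - rep (q a)) z.coeff := by
    rw [Finsupp.linearCombination_mapDomain, Finsupp.linearCombination_apply,
      Finsupp.linearCombination_apply, Finsupp.linearCombination_apply, ← Finsupp.sum_add]
    refine Finsupp.sum_congr fun a _ => ?_
    simp only [Function.comp, smul_eq_mul]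
    ring
  rw [he]
  refine dvd_add ?_ ?_
  · rw [Finsupp.linearCombination_apply]
    refine Finset.dvd_sum fun c _ => ?_
    exact (coeffAt_ofHom j U c z ▸ hz c).mul_right (rep c)
  · rw [Finsupp.linearCombination_apply]
    exact Finset.dvd_sum fun a _ => (hrep a).mul_left _

theorem exists_proj_ofHom_eq {U : OpenNormalSubgroup G}
    (hj : ∀ c : G ⧸ (U : Subgroup G), ∃ a, (QuotientGroup.mk (j a) : G ⧸ (U : Subgroup G)) = c)
    (x : CompletedGroupAlgebra p G) :
    ∃ z : MonoidAlgebra ℤ_[p] A, proj p G U (ofHom j z) = proj p G U x := by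
  obtain ⟨z, hz⟩ := Finsupp.mapDomain_surjective hj (proj p G U x).coeff
  refine ⟨MonoidAlgebra.ofCoeff z, MonoidAlgebra.ext (Finsupp.ext fun c => ?_)⟩
  rw [← hz]
  exact coeffAt_ofHom j U c _

/-- A basic neighbourhood constrains finitely many coefficients. All of them are determined at one
level `U` below the levels involved, where `x` can be matched exactly. -/
theorem denseRange_ofHom (hj : ∀ (U : OpenNormalSubgroup G) (c : G ⧸ (U : Subgroup G)),
    ∃ a, (QuotientGroup.mk (j a) : G ⧸ (U : Subgroup G)) = c) :
    DenseRange (ofHom (p := p) j) := by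
  intro x
  rw [mem_closure_iff_nhds, isInducing_coeffs.nhds_eq_comap]
  rintro t ⟨u, hu, hut⟩
  rw [nhds_pi, Filter.mem_pi] at hu
  obtain ⟨I, hI, v, hv, hvu⟩ := hu
  have hU : ∃ U : OpenNormalSubgroup G, ∀ q ∈ I, U ≤ q.1 := by
    clear hvu hv
    induction I, hI using Set.Finite.induction_on with
    | empty => exact ⟨⟨⊤, inferInstanceAs (⊤ : Subgroup G).Normal⟩, by simp⟩
    | insert _ _ ih =>
      rename_i q I _ _
      obtain ⟨U, hU⟩ := ih
      refine ⟨U ⊓ q.1, ?_⟩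
      rintro r (rfl | hr)
      · exact inf_le_right
      · exact inf_le_left.trans (hU r hr)
  obtain ⟨U, hU⟩ := hU
  obtain ⟨z, hz⟩ := exists_proj_ofHom_eq (p := p) j (hj U) x
  refine ⟨ofHom j z, hut (hvu fun q hq => ?_), z, rfl⟩
  have h1 : proj p G q.1 (ofHom j z) = proj p G q.1 x :=
    ((ofHom j z).2 U q.1 (hU q hq)).symm.trans ((congrArg (levelMap p G (hU q hq)) hz).trans
      (x.2 U q.1 (hU q hq)))
  have h2 : coeffs p G (ofHom j z) q = coeffs p G x q :=
    congrArg (fun w => MonoidAlgebra.coeff w q.2) h1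
  rw [h2]
  exact mem_of_mem_nhds (hv q)

/-- A function on `A` that is uniformly continuous for the topology induced by `j : A → G` extends
by linearity and continuity to `ℤ_p[[G]]`. -/
theorem exists_tendsto_linearCombination [∀ U : OpenNormalSubgroup G, Finite (G ⧸ (U : Subgroup G))]
    (hj : DenseRange (ofHom (p := p) j))
    {H : Type*} [Group H] [TopologicalSpace H] [CompactSpace (CompletedGroupAlgebra p H)]
    {f : A → CompletedGroupAlgebra p H}
    (hf : ∀ (V : OpenNormalSubgroup H) (c : H ⧸ (V : Subgroup H)) (s : ℕ),
      ∃ U : OpenNormalSubgroup G, ∀ a b,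
        (QuotientGroup.mk (j a) : G ⧸ (U : Subgroup G)) = QuotientGroup.mk (j b) →
          (p : ℤ_[p]) ^ s ∣ coeffAt p H V c (f a) - coeffAt p H V c (f b))
    (x : CompletedGroupAlgebra p G) :
    ∃ y, Tendsto (fun z : MonoidAlgebra ℤ_[p] A => Finsupp.linearCombination ℤ_[p] f z.coeff)
      (comap (ofHom j) (𝓝 x)) (𝓝 y) := by
  have hne : (comap (ofHom (p := p) j) (𝓝 x)).NeBot :=
    comap_neBot fun t ht => by
      obtain ⟨_, h, z, rfl⟩ := mem_closure_iff_nhds.1 (hj x) t ht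
      exact ⟨z, h⟩
  -- Compactness of the target gives a cluster point; the Cauchy estimate `key` makes it a limit.
  obtain ⟨y, hy⟩ := exists_clusterPt_of_compactSpace
    (map (fun z : MonoidAlgebra ℤ_[p] A => Finsupp.linearCombination ℤ_[p] f z.coeff)
      (comap (ofHom j) (𝓝 x)))
  refine ⟨y, tendsto_nhds_iff_coeffAt.2 fun V c => PadicInt.tendsto_nhds_of_pow_dvd_sub fun s => ?_⟩
  obtain ⟨U, hU⟩ := hf V c s
  have hN : ∀ᶠ z in comap (ofHom (p := p) j) (𝓝 x), ∀ d : G ⧸ (U : Subgroup G),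
      (p : ℤ_[p]) ^ s ∣ coeffAt p G U d (ofHom j z) - coeffAt p G U d x := by
    rw [eventually_all]
    intro d
    refine tendsto_comap.eventually (p := fun w => (p : ℤ_[p]) ^ s ∣ coeffAt p G U d w -
      coeffAt p G U d x) ?_
    exact (continuous_coeffAt U d).continuousAt.preimage_mem_nhds
      ((PadicInt.isClopen_setOf_pow_dvd_sub s _).isOpen.mem_nhds (by simp))
  have key : ∀ z z' : MonoidAlgebra ℤ_[p] A,
      (∀ d : G ⧸ (U : Subgroup G),
        (p : ℤ_[p]) ^ s ∣ coeffAt p G U d (ofHom j z) - coeffAt p G U d x) →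
      (∀ d : G ⧸ (U : Subgroup G),
        (p : ℤ_[p]) ^ s ∣ coeffAt p G U d (ofHom j z') - coeffAt p G U d x) →
      (p : ℤ_[p]) ^ s ∣ coeffAt p H V c (Finsupp.linearCombination ℤ_[p] f z.coeff) -
        coeffAt p H V c (Finsupp.linearCombination ℤ_[p] f z'.coeff) := by
    intro z z' hz hz'
    rw [coeffAt_linearCombination, coeffAt_linearCombination, ← map_sub]
    refine pow_dvd_linearCombination (z := z - z') j hU fun d => ?_
    rw [map_sub, map_sub]
    have := dvd_sub (hz d) (hz' d)
    rwa [sub_sub_sub_cancel_right] at this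
  obtain ⟨z₀, hz₀⟩ := hN.exists
  -- Congruence modulo `p^s` is a closed condition, so it passes to the cluster point.
  have hmem : (p : ℤ_[p]) ^ s ∣ coeffAt p H V c y -
      coeffAt p H V c (Finsupp.linearCombination ℤ_[p] f z₀.coeff) := by
    have hcl : IsClosed {w | (p : ℤ_[p]) ^ s ∣ coeffAt p H V c w -
        coeffAt p H V c (Finsupp.linearCombination ℤ_[p] f z₀.coeff)} :=
      (PadicInt.isClopen_setOf_pow_dvd_sub s _).isClosed.preimage (continuous_coeffAt V c)
    refine hcl.closure_subset (hy.mem_closure_of_mem _ (mem_map.2 ?_))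
    exact hN.mono fun z hz => key z z₀ hz hz₀
  filter_upwards [hN] with z hz
  have := dvd_sub (key z z₀ hz hz₀) hmem
  rwa [sub_sub_sub_cancel_right] at this

end

theorem coeffAt_of [∀ U : OpenNormalSubgroup G, DecidableEq (G ⧸ (U : Subgroup G))]
    (U : OpenNormalSubgroup G) (c : G ⧸ (U : Subgroup G)) (g : G) :
    coeffAt p G U c (of p G g) = if (QuotientGroup.mk g : G ⧸ (U : Subgroup G)) = c then 1 else 0 := by
  change Finsupp.mapDomain _ (Finsupp.single g 1) c = _
  rw [Finsupp.mapDomain_single, Finsupp.single_apply]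
  rfl

/-- Each coefficient of a group element is the indicator function of an open coset, hence locally
constant. -/
theorem continuous_of [IsTopologicalGroup G] : Continuous (of p G) := by
  classical
  rw [isInducing_coeffs.continuous_iff, continuous_pi_iff]
  rintro ⟨U, c⟩
  refine IsLocallyConstant.continuous ?_
  rw [IsLocallyConstant.iff_exists_open]
  intro x
  refine ⟨{y | x⁻¹ * y ∈ (U : Subgroup G)},
    U.isOpen'.preimage (continuous_const.mul continuous_id), by simp, fun y hy => ?_⟩
  simp only [coeffs, Function.comp, coeffAt_of]
  have : (QuotientGroup.mk y : G ⧸ (U : Subgroup G)) = QuotientGroup.mk x :=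
    (QuotientGroup.eq.2 hy).symm
  rw [this]

end CompletedGroupAlgebra

/-! ### Finite `p`-quotients and the topology of the free pro-`p` group -/

namespace PPowerNormal

variable {p n : ℕ}

instance : Top (PPowerNormal p n) := ⟨⟨⊤, inferInstance, 0, by simp⟩⟩

theorem exists_le_inf [Fact p.Prime] (N M : PPowerNormal p n) :
    ∃ K : PPowerNormal p n, K.1 ≤ N.1 ∧ K.1 ≤ M.1 := by
  obtain ⟨e, he⟩ := N.2.2
  obtain ⟨f, hf⟩ := M.2.2
  refine ⟨⟨N.1 ⊓ M.1, inferInstance, ?_⟩, inf_le_left, inf_le_right⟩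
  have h : (N.1 ⊓ M.1).index ∣ p ^ (e + f) := by
    rw [← Subgroup.relIndex_mul_index (inf_le_right : N.1 ⊓ M.1 ≤ M.1), Subgroup.inf_relIndex_right,
      pow_add, ← he, ← hf]
    exact mul_dvd_mul_right (Subgroup.relIndex_dvd_index_of_normal _ _) _
  obtain ⟨k, -, hk⟩ := (Nat.dvd_prime_pow Fact.out).1 h
  exact ⟨k, hk⟩

instance [Fact p.Prime] (N : PPowerNormal p n) : Finite (FreeGroup (Fin n) ⧸ N.1) := by
  obtain ⟨e, he⟩ := N.2.2
  have : N.1.FiniteIndex := ⟨he ▸ pow_ne_zero _ (Fact.out : p.Prime).ne_zero⟩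
  infer_instance

theorem exists_forall_le [Fact p.Prime] {I : Set (PPowerNormal p n)} (hI : I.Finite) :
    ∃ K : PPowerNormal p n, ∀ N ∈ I, K.1 ≤ N.1 := by
  induction I, hI using Set.Finite.induction_on with
  | empty => exact ⟨⊤, by simp⟩
  | insert _ _ ih =>
    rename_i N I _ _
    obtain ⟨K, hK⟩ := ih
    obtain ⟨L, hL1, hL2⟩ := exists_le_inf K N
    refine ⟨L, ?_⟩
    rintro r (rfl | hr)
    · exact hL2
    · exact hL1.trans (hK r hr)

end PPowerNormal

namespace FreeProP

variable {p n : ℕ}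

/-- The projection of the free pro-`p` group to a finite quotient of the free group. -/
def toQuotient (N : PPowerNormal p n) : FreeProP p n →* FreeGroup (Fin n) ⧸ N.1 :=
  (Pi.evalMonoidHom _ N).comp (freeProPSubgroup p n).subtype

theorem toQuotient_ofFreeGroup (N : PPowerNormal p n) (w : FreeGroup (Fin n)) :
    toQuotient N (ofFreeGroup p n w) = QuotientGroup.mk w := rfl

/-- The kernel of the projection to a finite quotient of the free group. -/
def level (N : PPowerNormal p n) : OpenNormalSubgroup (FreeProP p n) where
  toSubgroup := (toQuotient N).ker
  isOpen' := by
    let _ (N : PPowerNormal p n) : TopologicalSpace (FreeGroup (Fin n) ⧸ N.1) := ⊥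
    have (N : PPowerNormal p n) : DiscreteTopology (FreeGroup (Fin n) ⧸ N.1) := ⟨rfl⟩
    have h : Continuous fun x : FreeProP p n => toQuotient N x :=
      (continuous_apply N).comp continuous_induced_dom
    exact (isOpen_discrete {1}).preimage h
  isNormal' := inferInstance

theorem mem_level {N : PPowerNormal p n} {x : FreeProP p n} :
    x ∈ (level N : Subgroup (FreeProP p n)) ↔ toQuotient N x = 1 := Iff.rfl

/-- A basic neighbourhood constrains finitely many coordinates, and by compatibility the coordinate
at one `K` contained in all the subgroups involved determines them. -/
theorem exists_level_subset [Fact p.Prime] {t : Set (FreeProP p n)} (ht : t ∈ 𝓝 1) :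
    ∃ N : PPowerNormal p n, ((level N : Subgroup (FreeProP p n)) : Set (FreeProP p n)) ⊆ t := by
  let _ (N : PPowerNormal p n) : TopologicalSpace (FreeGroup (Fin n) ⧸ N.1) := ⊥
  rw [nhds_induced] at ht
  obtain ⟨u, hu, hut⟩ := ht
  rw [nhds_pi, Filter.mem_pi] at hu
  obtain ⟨I, hI, v, hv, hvu⟩ := hu
  obtain ⟨K, hK⟩ := PPowerNormal.exists_forall_le hI
  refine ⟨K, fun x hx => hut (hvu fun N hN => ?_)⟩
  have h : x.1 N = 1 := by
    rw [← x.2 K N (hK N hN), show x.1 K = 1 from hx, map_one]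
  change x.1 N ∈ v N
  rw [h]
  exact mem_of_mem_nhds (hv N)

theorem exists_level_le [Fact p.Prime] (U : OpenNormalSubgroup (FreeProP p n)) :
    ∃ N : PPowerNormal p n, level N ≤ U :=
  exists_level_subset (U.isOpen'.mem_nhds U.one_mem')

/-- `U` contains some `level N`, and modulo that level every element agrees with a word. This gives
density of words in the group and of `ℤ_p[F]` in the completed algebra. -/
theorem exists_mk_ofFreeGroup_eq [Fact p.Prime] (U : OpenNormalSubgroup (FreeProP p n))
    (c : FreeProP p n ⧸ (U : Subgroup (FreeProP p n))) :
    ∃ w, (QuotientGroup.mk (ofFreeGroup p n w) : FreeProP p n ⧸ (U : Subgroup (FreeProP p n))) =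
      c := by
  obtain ⟨x, rfl⟩ := QuotientGroup.mk_surjective c
  obtain ⟨N, hN⟩ := exists_level_le U
  obtain ⟨w, hw⟩ := QuotientGroup.mk_surjective (toQuotient N x)
  refine ⟨w, QuotientGroup.eq.2 (hN ?_)⟩
  change toQuotient N _ = 1
  rw [map_mul, map_inv, toQuotient_ofFreeGroup, hw, inv_mul_cancel]

theorem denseRange_ofFreeGroup [Fact p.Prime] : DenseRange (ofFreeGroup p n) := by
  intro x
  rw [mem_closure_iff_nhds]
  intro t ht
  have h : (fun y => x * y) ⁻¹' t ∈ 𝓝 (1 : FreeProP p n) := by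
    refine (continuous_const.mul continuous_id).continuousAt.preimage_mem_nhds ?_
    simpa using ht
  obtain ⟨N, hN⟩ := exists_level_subset h
  obtain ⟨w, hw⟩ := exists_mk_ofFreeGroup_eq (level N) (QuotientGroup.mk x)
  have := hN (QuotientGroup.eq.1 hw.symm)
  refine ⟨_, ?_, w, rfl⟩
  simpa using this

instance [Fact p.Prime] : CompactSpace (FreeProP p n) := by
  let _ (N : PPowerNormal p n) : TopologicalSpace (FreeGroup (Fin n) ⧸ N.1) := ⊥
  have (N : PPowerNormal p n) : DiscreteTopology (FreeGroup (Fin n) ⧸ N.1) := ⟨rfl⟩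
  refine IsClosedEmbedding.compactSpace (f := fun x : FreeProP p n => x.1)
    ⟨⟨⟨rfl⟩, Subtype.val_injective⟩, ?_⟩
  have h : Set.range (fun x : FreeProP p n => x.1) =
      ⋂ (N : PPowerNormal p n) (M : PPowerNormal p n) (h : N.1 ≤ M.1),
        {x | QuotientGroup.map N.1 M.1 (MonoidHom.id _) h (x N) = x M} := by
    ext x
    simp only [Set.mem_iInter, Set.mem_range, Set.mem_ofPred_eq]
    constructor
    · rintro ⟨y, rfl⟩
      exact y.2
    · exact fun hx => ⟨⟨x, hx⟩, rfl⟩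
  rw [h]
  exact isClosed_iInter fun N => isClosed_iInter fun M => isClosed_iInter fun h => isClosed_eq
    (continuous_of_discreteTopology.comp (continuous_apply N)) (continuous_apply M)

instance _root_.OpenNormalSubgroup.finite_quotient {G : Type*} [Group G] [TopologicalSpace G] [IsTopologicalGroup G]
    [CompactSpace G] (U : OpenNormalSubgroup G) : Finite (G ⧸ (U : Subgroup G)) :=
  Subgroup.quotient_finite_of_isOpen _ U.isOpen'

/-- A continuous function on a free pro-`p` group is uniformly locally constant modulo `p^s`. -/
theorem exists_forall_pow_dvd_sub [Fact p.Prime] {f : FreeProP p n → ℤ_[p]} (hf : Continuous f)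
    (s : ℕ) : ∃ U : OpenNormalSubgroup (FreeProP p n), ∀ a b,
      (QuotientGroup.mk a : FreeProP p n ⧸ (U : Subgroup (FreeProP p n))) = QuotientGroup.mk b →
        (p : ℤ_[p]) ^ s ∣ f a - f b := by
  let _ : UniformSpace (FreeProP p n) := IsTopologicalGroup.rightUniformSpace _
  have hu := CompactSpace.uniformContinuous_of_continuous hf
  have hp : 0 < (p : ℝ) ^ (-s : ℤ) :=
    zpow_pos (Nat.cast_pos.2 (Fact.out : p.Prime).pos) _
  have := hu (Metric.dist_mem_uniformity hp)
  rw [mem_map, uniformity_eq_comap_nhds_one'] at this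
  obtain ⟨t, ht, hts⟩ := this
  obtain ⟨N, hN⟩ := exists_level_subset ht
  refine ⟨level N, fun a b hab => ?_⟩
  -- The uniformity compares `b / a` while left cosets compare `a⁻¹ * b`; normality converts one
  -- into the other.
  have h1 : b * a⁻¹ ∈ (level N : Subgroup (FreeProP p n)) := by
    have h := (level N).isNormal'.conj_mem _ (QuotientGroup.eq.1 hab) a
    rwa [mul_inv_cancel_left] at h
  have h2 := @hts (a, b) (hN (by simpa [div_eq_mul_inv] using h1))
  rw [← Ideal.mem_span_singleton, ← PadicInt.norm_le_pow_iff_mem_span_pow, ← dist_eq_norm]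
  exact le_of_lt h2

end FreeProP

/-! ### Continuity of the Fox derivatives -/

section Fox

variable {p : ℕ} [Fact p.Prime] {n : ℕ}

namespace FreeProP

/-- Reduction of the group algebra of the free group to a finite group algebra. -/
def reduction (V : OpenNormalSubgroup (FreeProP p n)) (s : ℕ) :
    MonoidAlgebra ℤ_[p] (FreeGroup (Fin n)) →+*
      MonoidAlgebra (ZMod (p ^ s)) (FreeProP p n ⧸ (V : Subgroup (FreeProP p n))) :=
  (MonoidAlgebra.mapRingHom _ (PadicInt.toZModPow s)).comp
    ((CompletedGroupAlgebra.proj p _ V).comp (freeToCompleted p n) : _ →+* _)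

theorem coeff_reduction (V : OpenNormalSubgroup (FreeProP p n)) (s : ℕ)
    (z : MonoidAlgebra ℤ_[p] (FreeGroup (Fin n)))
    (c : FreeProP p n ⧸ (V : Subgroup (FreeProP p n))) :
    (reduction V s z).coeff c =
      PadicInt.toZModPow s (CompletedGroupAlgebra.coeffAt p _ V c (freeToCompleted p n z)) := by
  rfl

theorem reduction_of (V : OpenNormalSubgroup (FreeProP p n)) (s : ℕ) {w : FreeGroup (Fin n)}
    (hw : ofFreeGroup p n w ∈ (V : Subgroup (FreeProP p n))) :
    reduction V s (MonoidAlgebra.of _ _ w) = 1 := by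
  have h : CompletedGroupAlgebra.proj p _ V (freeToCompleted p n (MonoidAlgebra.of _ _ w)) =
      MonoidAlgebra.single (QuotientGroup.mk (ofFreeGroup p n w)) 1 := by
    change MonoidAlgebra.mapDomainAlgHom ℤ_[p] ℤ_[p] (QuotientGroup.mk' (V : Subgroup _))
      (MonoidAlgebra.mapDomainAlgHom ℤ_[p] ℤ_[p] (ofFreeGroup p n) (MonoidAlgebra.single w 1)) = _
    simp
  change MonoidAlgebra.mapRingHom _ (PadicInt.toZModPow s)
    (CompletedGroupAlgebra.proj p _ V (freeToCompleted p n (MonoidAlgebra.of _ _ w))) = 1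
  rw [h, (QuotientGroup.eq_one_iff _).2 hw]
  simp [MonoidAlgebra.one_def]

instance (V : OpenNormalSubgroup (FreeProP p n)) (s : ℕ) :
    Finite (MonoidAlgebra (ZMod (p ^ s)) (FreeProP p n ⧸ (V : Subgroup (FreeProP p n)))) := by
  have : NeZero (p ^ s) := ⟨pow_ne_zero _ (Fact.out : p.Prime).ne_zero⟩
  refine Finite.of_injective (fun x c => x.coeff c) fun x y h => ?_
  exact MonoidAlgebra.ext (Finsupp.ext fun c => congrFun h c)

/-- The representation of the free group that computes the reduction of the Fox derivative. -/
def foxHom (V : OpenNormalSubgroup (FreeProP p n)) (s : ℕ) (i : Fin n) :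
    FreeGroup (Fin n) →* (Matrix (Fin 2) (Fin 2)
      (MonoidAlgebra (ZMod (p ^ s)) (FreeProP p n ⧸ (V : Subgroup (FreeProP p n)))))ˣ :=
  (Units.map (reduction V s).mapMatrix.toMonoidHom).comp (FreeGroup.lift (foxUnit p n i))

theorem foxHom_apply (V : OpenNormalSubgroup (FreeProP p n)) (s : ℕ) (i : Fin n)
    (w : FreeGroup (Fin n)) : (foxHom V s i w).1 =
      !![reduction V s (MonoidAlgebra.of _ _ w), reduction V s (foxGroup p n i w); 0, 1] := by
  change (reduction V s).mapMatrix (FreeGroup.lift (foxUnit p n i) w).1 = _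
  rw [fox_lift_eq, RingHom.mapMatrix_apply]
  ext a b
  fin_cases a <;> fin_cases b <;> simp

/-- The image is finite because the coefficient ring is. It is a `p`-group: some `w ^ p ^ e` falls
into `V`, where the matrix becomes unipotent with corner `d`; its `k`-th power has corner `k * d`,
and `p ^ s` kills the ring. So the reduced Fox derivative factors through a finite `p`-quotient of
the free group. -/
theorem exists_ker_foxHom_eq (V : OpenNormalSubgroup (FreeProP p n)) (s : ℕ) (i : Fin n) :
    ∃ M : PPowerNormal p n, M.1 = (foxHom V s i).ker := by
  have hfin : Finite (FreeGroup (Fin n) ⧸ (foxHom V s i).ker) :=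
    Finite.of_equiv _ (QuotientGroup.quotientKerEquivRange (foxHom V s i)).symm.toEquiv
  have hp : IsPGroup p (FreeGroup (Fin n) ⧸ (foxHom V s i).ker) := by
    intro g
    obtain ⟨w, rfl⟩ := QuotientGroup.mk_surjective g
    obtain ⟨N, hN⟩ := exists_level_le V
    obtain ⟨e, he⟩ := N.2.2
    have hw : ofFreeGroup p n (w ^ p ^ e) ∈ (V : Subgroup (FreeProP p n)) := by
      refine hN ?_
      change toQuotient N _ = 1
      rw [toQuotient_ofFreeGroup, QuotientGroup.mk_pow, ← he, Subgroup.index, pow_card_eq_one']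
    have hpow : ∀ k : ℕ, ((foxHom V s i (w ^ p ^ e)) ^ k).1 =
        !![1, (k : MonoidAlgebra (ZMod (p ^ s)) (FreeProP p n ⧸ (V : Subgroup (FreeProP p n)))) *
          reduction V s (foxGroup p n i (w ^ p ^ e)); 0, 1] := by
      intro k
      induction k with
      | zero => simp [Matrix.one_fin_two]
      | succ k ih =>
        rw [pow_succ, Units.val_mul, ih, foxHom_apply, reduction_of V s hw, Matrix.mul_fin_two]
        simp [add_mul, add_comm]
    have hzero : ((p ^ s : ℕ) :
        MonoidAlgebra (ZMod (p ^ s)) (FreeProP p n ⧸ (V : Subgroup (FreeProP p n)))) = 0 := by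
      rw [← map_natCast (algebraMap (ZMod (p ^ s)) _), ZMod.natCast_self, map_zero]
    refine ⟨e + s, ?_⟩
    rw [← QuotientGroup.mk_pow, QuotientGroup.eq_one_iff, MonoidHom.mem_ker, pow_add, pow_mul,
      map_pow]
    refine Units.ext ?_
    rw [hpow, hzero, zero_mul, Units.val_one, Matrix.one_fin_two]
  obtain ⟨e, he⟩ := IsPGroup.iff_card.1 hp
  exact ⟨⟨_, inferInstance, e, he⟩, rfl⟩

end FreeProP

open FreeProP CompletedGroupAlgebra

/-- Words congruent modulo `ker (foxHom V s i)` have the same reduced derivative, the upper right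
entry. This is the uniform continuity required for extension. -/
theorem exists_tendsto_foxGroup (i : Fin n) (x : CompletedGroupAlgebra p (FreeProP p n)) :
    ∃ y, Tendsto (fun z : MonoidAlgebra ℤ_[p] (FreeGroup (Fin n)) =>
      Finsupp.linearCombination ℤ_[p] (fun w => freeToCompleted p n (foxGroup p n i w)) z.coeff)
      (comap (freeToCompleted p n) (𝓝 x)) (𝓝 y) := by
  refine exists_tendsto_linearCombination (ofFreeGroup p n)
    (denseRange_ofHom _ exists_mk_ofFreeGroup_eq) (fun V c s => ?_) x
  obtain ⟨M, hM⟩ := exists_ker_foxHom_eq V s i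
  refine ⟨level M, fun a b hab => ?_⟩
  have h1 : a⁻¹ * b ∈ M.1 := by
    have h := mem_level.1 (QuotientGroup.eq.1 hab)
    rwa [← map_inv, ← map_mul, toQuotient_ofFreeGroup, QuotientGroup.eq_one_iff] at h
  rw [hM, MonoidHom.mem_ker, map_mul, map_inv, inv_mul_eq_one] at h1
  have h2 : reduction V s (foxGroup p n i a) = reduction V s (foxGroup p n i b) := by
    have h := congrArg (fun u => u.1 0 1) h1
    simpa [foxHom_apply] using h
  have h3 := congrArg (fun u => MonoidAlgebra.coeff u c) h2
  simp only [coeff_reduction] at h3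
  rw [← Ideal.mem_span_singleton, ← PadicInt.ker_toZModPow, RingHom.mem_ker, map_sub, h3, sub_self]

/-- The `limUnder` defining `foxDeriv` is thus a genuine limit rather than a default value. -/
theorem tendsto_foxDeriv (i : Fin n) (x : CompletedGroupAlgebra p (FreeProP p n)) :
    Tendsto (fun z : MonoidAlgebra ℤ_[p] (FreeGroup (Fin n)) => freeToCompleted p n
      (Finsupp.linearCombination ℤ_[p] (foxGroup p n i) z.coeff))
      (comap (freeToCompleted p n) (𝓝 x)) (𝓝 (foxDeriv p n i x)) := by
  refine tendsto_nhds_limUnder ?_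
  obtain ⟨y, hy⟩ := exists_tendsto_foxGroup i x
  refine ⟨y, hy.congr fun z => ?_⟩
  exact (Finsupp.apply_linearCombination ℤ_[p] (freeToCompleted p n).toLinearMap _ _).symm

/-- The Fox derivative of an element of the free pro-`p` group is the limit of the Fox derivatives
of approximating elements of the free group. -/
theorem tendsto_foxGroup (i : Fin n) (r : FreeProP p n) :
    Tendsto (fun w => freeToCompleted p n (foxGroup p n i w)) (comap (ofFreeGroup p n) (𝓝 r))
      (𝓝 (foxDeriv p n i (of p (FreeProP p n) r))) := by
  have h : Tendsto (MonoidAlgebra.of ℤ_[p] (FreeGroup (Fin n))) (comap (ofFreeGroup p n) (𝓝 r))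
      (comap (freeToCompleted p n) (𝓝 (of p (FreeProP p n) r))) := by
    rw [tendsto_comap_iff]
    have he : ⇑(freeToCompleted p n) ∘ ⇑(MonoidAlgebra.of ℤ_[p] (FreeGroup (Fin n))) =
        of p (FreeProP p n) ∘ ofFreeGroup p n := by
      funext w
      simp [freeToCompleted, of]
    rw [he]
    exact (continuous_of.tendsto r).comp tendsto_comap
  refine ((tendsto_foxDeriv i _).comp h).congr fun w => ?_
  simp

end Fox

/-! ### The specialization `γ = a` is continuous and multiplicative -/

section Evaluation

open CompletedGroupAlgebra

variable {p : ℕ} [Fact p.Prime] {γ : Gam p} (hγ : Dense (Subgroup.zpowers γ : Set (Gam p)))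
  {a : PadicAlgCl p} (ha : ‖a - 1‖ < 1)

include ha in
theorem max_norm_sub_one_lt_one : max ‖a - 1‖ (p : ℝ)⁻¹ < 1 :=
  max_lt ha (inv_lt_one_of_one_lt₀ (by exact_mod_cast (Fact.out : p.Prime).one_lt))

theorem max_norm_sub_one_nonneg : 0 ≤ max ‖a - 1‖ (p : ℝ)⁻¹ :=
  le_max_of_le_left (norm_nonneg _)

theorem tendsto_evalStep (x : CompletedGroupAlgebra p (Gam p)) :
    Tendsto (fun N => evalStep γ a N x) atTop (𝓝 (evalCompleted γ hγ a ha x)) :=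
  tendsto_nhds_limUnder (exists_tendsto_evalStep hγ ha x)

include hγ ha in
theorem norm_evalStep_sub_evalStep_le {N M : ℕ} (h : N ≤ M) (x : CompletedGroupAlgebra p (Gam p)) :
    ‖evalStep γ a M x - evalStep γ a N x‖ ≤ max ‖a - 1‖ (p : ℝ)⁻¹ ^ N := by
  induction M, h using Nat.le_induction with
  | base => simp [pow_nonneg max_norm_sub_one_nonneg N]
  | succ M hM ih =>
    rw [← sub_add_sub_cancel _ (evalStep γ a M x)]
    refine (PadicAlgCl.isNonarchimedean p _ _).trans (max_le ?_ ih)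
    exact (norm_evalStep_sub_le hγ ha M x).trans (pow_le_pow_of_le_one max_norm_sub_one_nonneg
      (max_norm_sub_one_lt_one ha).le hM)

theorem norm_evalCompleted_sub_evalStep_le (N : ℕ) (x : CompletedGroupAlgebra p (Gam p)) :
    ‖evalCompleted γ hγ a ha x - evalStep γ a N x‖ ≤ max ‖a - 1‖ (p : ℝ)⁻¹ ^ N := by
  refine le_of_tendsto ((tendsto_evalStep hγ ha x).sub_const _).norm ?_
  filter_upwards [eventually_ge_atTop N] with M hM
  exact norm_evalStep_sub_evalStep_le hγ ha hM x

theorem continuous_algebraMap_padicAlgCl : Continuous (algebraMap ℤ_[p] (PadicAlgCl p)) := by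
  rw [IsScalarTower.algebraMap_eq ℤ_[p] ℚ_[p] (PadicAlgCl p)]
  exact (continuous_algebraMap ℚ_[p] (PadicAlgCl p)).comp continuous_subtype_val

theorem continuous_evalStep (N : ℕ) : Continuous (evalStep γ a N) := by
  have h : ⇑(evalStep γ a N) = fun x => ∑ j ∈ Finset.range (p ^ N),
      algebraMap ℤ_[p] (PadicAlgCl p) (coeffAt p (Gam p) (gamLevel p N) (QuotientGroup.mk (γ ^ j)) x)
        * a ^ j := by
    funext x
    simp only [evalStep_apply, Algebra.smul_def]
  rw [h]
  exact continuous_finsetSum _ fun j _ =>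
    (continuous_algebraMap_padicAlgCl.comp (continuous_coeffAt _ _)).mul continuous_const

/-- The truncations are continuous and converge at a geometric rate independent of `x`, hence
uniformly. -/
theorem continuous_evalCompleted : Continuous (evalCompleted γ hγ a ha) := by
  have h : TendstoUniformly (fun N x => evalStep γ a N x) (evalCompleted γ hγ a ha) atTop := by
    rw [Metric.tendstoUniformly_iff]
    intro ε hε
    have h0 := (tendsto_pow_atTop_nhds_zero_of_lt_one max_norm_sub_one_nonneg
      (max_norm_sub_one_lt_one ha)).eventually (gt_mem_nhds hε)
    filter_upwards [h0] with N hN x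
    rw [dist_eq_norm]
    exact (norm_evalCompleted_sub_evalStep_le hγ ha N x).trans_lt hN
  exact h.continuous (Frequently.of_forall fun N => continuous_evalStep N)

theorem evalCompleted_one : evalCompleted γ hγ a ha 1 = 1 := by
  classical
  refine tendsto_nhds_unique (tendsto_evalStep hγ ha 1) (tendsto_const_nhds.congr fun N => ?_)
  have hpos : 0 < p ^ N := pow_pos (Fact.out : p.Prime).pos N
  have h0 : ((0 : ℕ) : ℕ) ∈ Finset.range (p ^ N) := Finset.mem_range.2 hpos
  rw [evalStep_apply, Finset.sum_eq_single_of_mem 0 h0]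
  · rw [← map_one (of p (Gam p)), coeffAt_of, if_pos (by rw [pow_zero])]
    simp
  · intro j hj hj0
    rw [← map_one (of p (Gam p)), coeffAt_of, if_neg, zero_smul]
    rw [← pow_zero γ, gam_mk_eq_iff hγ, Nat.zero_mod, Nat.mod_eq_of_lt (Finset.mem_range.1 hj)]
    exact hj0.symm

include hγ in
-- Multiplication at level `N` is cyclic convolution, so exponents wrap modulo `p ^ N`. The wrapping
-- is the only obstruction to multiplicativity of `evalStep`.
theorem evalStep_mul (N : ℕ) (x y : CompletedGroupAlgebra p (Gam p)) :
    evalStep γ a N (x * y) = ∑ i ∈ Finset.range (p ^ N), ∑ j ∈ Finset.range (p ^ N),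
      (coeffAt p (Gam p) (gamLevel p N) (QuotientGroup.mk (γ ^ i)) x *
        coeffAt p (Gam p) (gamLevel p N) (QuotientGroup.mk (γ ^ j)) y) •
          a ^ ((i + j) % p ^ N) := by
  classical
  have hpos : 0 < p ^ N := pow_pos (Fact.out : p.Prime).pos N
  have hsum : ∀ z : MonoidAlgebra ℤ_[p] (Gam p ⧸ (gamLevel p N : Subgroup (Gam p))),
      z = ∑ j ∈ Finset.range (p ^ N),
        MonoidAlgebra.single (QuotientGroup.mk (γ ^ j)) (z.coeff (QuotientGroup.mk (γ ^ j))) := by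
    intro z
    refine MonoidAlgebra.ext ?_
    rw [MonoidAlgebra.coeff_sum]
    exact gam_level_eq_sum hγ N z.coeff
  have hxy : proj p (Gam p) (gamLevel p N) (x * y) =
      ∑ i ∈ Finset.range (p ^ N), ∑ j ∈ Finset.range (p ^ N),
        MonoidAlgebra.single (QuotientGroup.mk (γ ^ (i + j)))
          (coeffAt p (Gam p) (gamLevel p N) (QuotientGroup.mk (γ ^ i)) x *
        coeffAt p (Gam p) (gamLevel p N) (QuotientGroup.mk (γ ^ j)) y) := by
    rw [map_mul]
    conv_lhs => rw [hsum (proj p (Gam p) (gamLevel p N) x), hsum (proj p (Gam p) (gamLevel p N) y)]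
    rw [Finset.sum_mul_sum]
    refine Finset.sum_congr rfl fun i _ => Finset.sum_congr rfl fun j _ => ?_
    rw [MonoidAlgebra.single_mul_single, ← QuotientGroup.mk_mul, ← pow_add]
    rfl
  have hco : ∀ l, coeffAt p (Gam p) (gamLevel p N) (QuotientGroup.mk (γ ^ l)) (x * y) =
      ∑ i ∈ Finset.range (p ^ N), ∑ j ∈ Finset.range (p ^ N),
        if (i + j) % p ^ N = l % p ^ N then
          (coeffAt p (Gam p) (gamLevel p N) (QuotientGroup.mk (γ ^ i)) x *
            coeffAt p (Gam p) (gamLevel p N) (QuotientGroup.mk (γ ^ j)) y) else 0 := by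
    intro l
    change (proj p (Gam p) (gamLevel p N) (x * y)).coeff _ = _
    rw [hxy, MonoidAlgebra.coeff_sum, Finsupp.finsetSum_apply]
    refine Finset.sum_congr rfl fun i _ => ?_
    rw [MonoidAlgebra.coeff_sum, Finsupp.finsetSum_apply]
    refine Finset.sum_congr rfl fun j _ => ?_
    rw [MonoidAlgebra.coeff_single, Finsupp.single_apply]
    exact if_congr (gam_mk_eq_iff hγ N _ _) rfl rfl
  rw [evalStep_apply]
  simp only [hco, Finset.sum_smul]
  rw [Finset.sum_comm]
  refine Finset.sum_congr rfl fun i _ => ?_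
  rw [Finset.sum_comm]
  refine Finset.sum_congr rfl fun j _ => ?_
  rw [Finset.sum_eq_single_of_mem ((i + j) % p ^ N) (Finset.mem_range.2 (Nat.mod_lt _ hpos))]
  · rw [Nat.mod_mod, if_pos rfl]
  · intro l hl hne
    rw [Nat.mod_eq_of_lt (Finset.mem_range.1 hl), if_neg (Ne.symm hne), zero_smul]

/-- The wrap-around error is small because `a ^ p ^ N` is close to `1`. -/
theorem norm_pow_mod_sub_pow_le (ha : ‖a - 1‖ < 1) (N k : ℕ) :
    ‖a ^ k - a ^ (k % p ^ N)‖ ≤ max ‖a - 1‖ (p : ℝ)⁻¹ ^ N := by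
  have hN := norm_pow_prime_pow_sub_one_le ha N
  have hb1 : ‖a ^ p ^ N - 1‖ ≤ 1 := ((norm_pow_sub_one_le ha.le _).2).trans ha.le
  have he : a ^ k - a ^ (k % p ^ N) = a ^ (k % p ^ N) * ((a ^ p ^ N) ^ (k / p ^ N) - 1) := by
    rw [mul_sub, mul_one, ← pow_mul, ← pow_add, Nat.mod_add_div]
  rw [he, norm_mul, norm_pow]
  refine (mul_le_of_le_one_left (norm_nonneg _)
    (pow_le_one₀ (norm_nonneg _) (norm_pow_sub_one_le ha.le 0).1)).trans ?_
  exact ((norm_pow_sub_one_le hb1 _).2).trans hN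

include hγ ha in
theorem norm_evalStep_mul_sub_le (N : ℕ) (x y : CompletedGroupAlgebra p (Gam p)) :
    ‖evalStep γ a N x * evalStep γ a N y - evalStep γ a N (x * y)‖ ≤
      max ‖a - 1‖ (p : ℝ)⁻¹ ^ N := by
  have hC : 0 ≤ max ‖a - 1‖ (p : ℝ)⁻¹ ^ N := pow_nonneg max_norm_sub_one_nonneg N
  rw [evalStep_mul hγ, evalStep_apply, evalStep_apply, Finset.sum_mul_sum, ← Finset.sum_sub_distrib]
  refine padic_norm_sum_le_of_le _ _ hC fun i _ => ?_
  rw [← Finset.sum_sub_distrib]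
  refine padic_norm_sum_le_of_le _ _ hC fun j _ => ?_
  rw [smul_mul_smul_comm, ← pow_add, ← smul_sub, Algebra.smul_def, norm_mul]
  exact (mul_le_of_le_one_left (norm_nonneg _) (norm_algebraMap_padicInt_le _)).trans
    (norm_pow_mod_sub_pow_le ha N _)

theorem evalCompleted_mul (x y : CompletedGroupAlgebra p (Gam p)) :
    evalCompleted γ hγ a ha (x * y) = evalCompleted γ hγ a ha x * evalCompleted γ hγ a ha y := by
  have h1 := ((tendsto_evalStep hγ ha x).mul (tendsto_evalStep hγ ha y)).sub
    (tendsto_evalStep hγ ha (x * y))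
  have h2 : Tendsto (fun N => evalStep γ a N x * evalStep γ a N y - evalStep γ a N (x * y)) atTop
      (𝓝 0) :=
    squeeze_zero_norm (norm_evalStep_mul_sub_le hγ ha · x y)
      (tendsto_pow_atTop_nhds_zero_of_lt_one max_norm_sub_one_nonneg (max_norm_sub_one_lt_one ha))
  exact (sub_eq_zero.1 (tendsto_nhds_unique h1 h2)).symm

theorem evalAt_tmul (e : PadicAlgCl p) (x : CompletedGroupAlgebra p (Gam p)) :
    evalAt γ hγ a ha (e ⊗ₜ x) = e * evalCompleted γ hγ a ha x := by
  rw [evalAt, LinearMap.liftBaseChange_tmul, smul_eq_mul]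

/-- The specialization `γ = a` as a ring homomorphism. -/
def evalAtHom : ExtCompletedGroupAlgebra p (Gam p) →+* PadicAlgCl p where
  toFun := evalAt γ hγ a ha
  map_one' := by
    rw [Algebra.TensorProduct.one_def, evalAt_tmul, evalCompleted_one, mul_one]
  map_zero' := map_zero _
  map_add' := map_add _
  map_mul' x y := by
    induction x using TensorProduct.induction_on with
    | zero => simp
    | add x x' hx hx' => rw [add_mul, map_add, hx, hx', map_add, add_mul]
    | tmul e x =>
      induction y using TensorProduct.induction_on with
      | zero => simp
      | add y y' hy hy' => rw [mul_add, map_add, hy, hy', map_add, mul_add]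
      | tmul e' y =>
        rw [Algebra.TensorProduct.tmul_mul_tmul, evalAt_tmul, evalAt_tmul, evalAt_tmul,
          evalCompleted_mul, mul_mul_mul_comm]

theorem evalAtHom_apply (x : ExtCompletedGroupAlgebra p (Gam p)) :
    evalAtHom hγ ha x = evalAt γ hγ a ha x := rfl

end Evaluation

/-! ### The surjection `ℤ_p[[T]] → ℤ_p[[Γ]]` -/

section Iwasawa

open CompletedGroupAlgebra Polynomial

variable {p : ℕ} [Fact p.Prime]

theorem exists_gamLevel_le (U : OpenNormalSubgroup (Gam p)) : ∃ N, gamLevel p N ≤ U := by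
  have h : {x : ℤ_[p] | Multiplicative.ofAdd x ∈ (U : Subgroup (Gam p))} ∈ 𝓝 (0 : ℤ_[p]) :=
    (U.isOpen'.preimage continuous_ofAdd).mem_nhds U.one_mem'
  rw [Metric.mem_nhds_iff] at h
  obtain ⟨ε, hε, hU⟩ := h
  obtain ⟨N, hN⟩ := exists_pow_lt_of_lt_one hε (inv_lt_one_of_one_lt₀
    (by exact_mod_cast (Fact.out : p.Prime).one_lt : (1 : ℝ) < p))
  refine ⟨N, fun x hx => ?_⟩
  have hx' : (p : ℤ_[p]) ^ N ∣ x.toAdd := hx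
  rw [← Ideal.mem_span_singleton, ← PadicInt.norm_le_pow_iff_mem_span_pow] at hx'
  refine @hU x.toAdd ?_
  rw [mem_ball_zero_iff]
  refine hx'.trans_lt ?_
  simpa using hN

variable (p) in
/-- The polynomial `ω_N = (1 + T)^(p^N) - 1`. -/
def omegaPoly (N : ℕ) : ℤ_[p][X] := (X + C 1) ^ p ^ N - C 1

theorem natDegree_omegaPoly (N : ℕ) : (omegaPoly p N).natDegree = p ^ N := by
  rw [omegaPoly, natDegree_sub_C, (monic_X_add_C 1).natDegree_pow, natDegree_X_add_C, mul_one]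

theorem monic_omegaPoly (N : ℕ) : (omegaPoly p N).Monic := by
  have hpos : 0 < p ^ N := pow_pos (Fact.out : p.Prime).pos N
  refine ((monic_X_add_C 1).pow _).sub_of_left (degree_C_le.trans_lt ?_)
  rw [degree_eq_natDegree ((monic_X_add_C 1).pow _).ne_zero, (monic_X_add_C 1).natDegree_pow,
    natDegree_X_add_C, mul_one]
  exact_mod_cast hpos

/-- The lower coefficients are `0` and binomials `choose (p ^ N) k` divisible by `p`. Weierstrass
division then identifies `ℤ_p[T]/ω_N` with `ℤ_p[[T]]/ω_N`. -/
theorem isDistinguishedAt_omegaPoly (N : ℕ) :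
    (omegaPoly p N).IsDistinguishedAt (IsLocalRing.maximalIdeal ℤ_[p]) where
  monic := monic_omegaPoly N
  mem {k} hk := by
    rw [natDegree_omegaPoly] at hk
    rw [omegaPoly, coeff_sub, coeff_X_add_C_pow, coeff_C]
    split_ifs with h0
    · simp [h0]
    · rw [one_pow, one_mul, sub_zero, PadicInt.maximalIdeal_eq_span_p, Ideal.mem_span_singleton]
      exact_mod_cast Nat.cast_dvd_cast
        ((Fact.out : p.Prime).dvd_choose_pow h0 hk.ne)

theorem omegaPoly_dvd {N M : ℕ} (h : N ≤ M) : omegaPoly p N ∣ omegaPoly p M := by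
  obtain ⟨k, hk⟩ := pow_dvd_pow p h
  rw [omegaPoly, omegaPoly, hk, pow_mul, C_1]
  simpa using sub_dvd_pow_sub_pow ((X + 1 : ℤ_[p][X]) ^ p ^ N) 1 k

variable (γ : Gam p)

/-- The homomorphism `ℤ_p[T] → ℤ_p[Γ/Γ^(p^N)]` with `T ↦ γ - 1`. -/
def polyHom (N : ℕ) :
    ℤ_[p][X] →ₐ[ℤ_[p]] MonoidAlgebra ℤ_[p] (Gam p ⧸ (gamLevel p N : Subgroup (Gam p))) :=
  aeval (MonoidAlgebra.single (QuotientGroup.mk γ) 1 - 1)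

theorem polyHom_comp (N : ℕ) (t : ℤ_[p][X]) : polyHom γ N (t.comp (X + C 1)) =
    ∑ j ∈ Finset.range (t.natDegree + 1),
      MonoidAlgebra.single (QuotientGroup.mk (γ ^ j)) (t.coeff j) := by
  rw [polyHom, aeval_comp, aeval_eq_sum_range]
  refine Finset.sum_congr rfl fun j _ => ?_
  simp [MonoidAlgebra.single_pow, MonoidAlgebra.smul_single]

theorem levelMap_polyHom {N M : ℕ} (h : gamLevel p M ≤ gamLevel p N) (q : ℤ_[p][X]) :
    levelMap p (Gam p) h (polyHom γ M q) = polyHom γ N q := by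
  rw [← AlgHom.comp_apply]
  congr 1
  refine Polynomial.algHom_ext ?_
  simp only [AlgHom.comp_apply, polyHom, aeval_X, map_sub, map_one, levelMap,
    MonoidAlgebra.mapDomainAlgHom_apply, MonoidAlgebra.mapDomain_single]
  rfl

variable {γ} (hγ : Dense (Subgroup.zpowers γ : Set (Gam p)))

include hγ

theorem polyHom_surjective (N : ℕ) : Function.Surjective (polyHom γ N) := by
  intro z
  have h : z = ∑ j ∈ Finset.range (p ^ N),
      MonoidAlgebra.single (QuotientGroup.mk (γ ^ j)) (z.coeff (QuotientGroup.mk (γ ^ j))) := by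
    refine MonoidAlgebra.ext ?_
    rw [MonoidAlgebra.coeff_sum]
    exact gam_level_eq_sum hγ N z.coeff
  rw [h]
  refine ⟨∑ j ∈ Finset.range (p ^ N),
    z.coeff (QuotientGroup.mk (γ ^ j)) • (X + C 1) ^ j, ?_⟩
  rw [map_sum]
  refine Finset.sum_congr rfl fun j _ => ?_
  simp [polyHom, MonoidAlgebra.single_pow, MonoidAlgebra.smul_single]

/-- Only the remainder modulo the monic `ω_N` matters. It has degree below `p ^ N`; expanded in
powers of `1 + T ↦ γ`, its coefficients sit at distinct cosets and can be read off. -/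
theorem polyHom_eq_zero_iff (N : ℕ) (q : ℤ_[p][X]) : polyHom γ N q = 0 ↔ omegaPoly p N ∣ q := by
  classical
  have hω : polyHom γ N (omegaPoly p N) = 0 := by
    have h : (QuotientGroup.mk (γ ^ p ^ N) : Gam p ⧸ (gamLevel p N : Subgroup (Gam p))) = 1 := by
      rw [← QuotientGroup.mk_one, ← pow_zero γ, gam_mk_eq_iff hγ]
      simp
    rw [QuotientGroup.mk_pow] at h
    simp [polyHom, omegaPoly, MonoidAlgebra.single_pow, h, MonoidAlgebra.one_def]
  constructor
  · intro hq
    rw [← modByMonic_eq_zero_iff_dvd (monic_omegaPoly N)]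
    set r := q %ₘ omegaPoly p N with hr
    have hdeg : r.natDegree < p ^ N := by
      rw [← natDegree_omegaPoly (p := p) N]
      refine natDegree_modByMonic_lt _ (monic_omegaPoly N) fun h => ?_
      have := natDegree_omegaPoly (p := p) N
      rw [h, natDegree_one] at this
      exact (pow_pos (Fact.out : p.Prime).pos N).ne this
    have hr0 : polyHom γ N r = 0 := by
      have h := congrArg (polyHom γ N) (modByMonic_add_div q (omegaPoly p N))
      rw [map_add, map_mul, hω, zero_mul, add_zero, hq] at h
      exact h
    set t := r.comp (X - C 1) with ht
    have hrt : r = t.comp (X + C 1) := by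
      rw [ht, comp_assoc]
      simp
    have htdeg : t.natDegree < p ^ N := by
      rw [ht, natDegree_comp, natDegree_X_sub_C, mul_one]
      exact hdeg
    have ht0 : t = 0 := by
      refine Polynomial.ext fun k => ?_
      rw [coeff_zero]
      by_cases hk : k < t.natDegree + 1
      · rw [hrt, polyHom_comp] at hr0
        have h := congrArg (fun z => MonoidAlgebra.coeff z (QuotientGroup.mk (γ ^ k))) hr0
        simp only [MonoidAlgebra.coeff_sum, Finsupp.finsetSum_apply] at h
        rw [Finset.sum_eq_single_of_mem k (Finset.mem_range.2 hk)] at h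
        · simpa using h
        · intro j hj hjk
          rw [MonoidAlgebra.coeff_single, Finsupp.single_apply, if_neg]
          rw [gam_mk_eq_iff hγ, Nat.mod_eq_of_lt, Nat.mod_eq_of_lt]
          · exact hjk
          · omega
          · have := Finset.mem_range.1 hj
            omega
      · exact coeff_eq_zero_of_natDegree_lt (by omega)
    rw [hrt, ht0, zero_comp]
  · rintro ⟨s, rfl⟩
    rw [map_mul, hω, zero_mul]

/-- The homomorphism `ℤ_p[[T]] → ℤ_p[Γ/Γ^(p^N)]` with `T ↦ γ - 1`. -/
def seriesHom (N : ℕ) :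
    PowerSeries ℤ_[p] →ₐ[ℤ_[p]] MonoidAlgebra ℤ_[p] (Gam p ⧸ (gamLevel p N : Subgroup (Gam p))) :=
  (Ideal.Quotient.liftₐ (Ideal.span {omegaPoly p N}) (polyHom γ N) fun q hq =>
    (polyHom_eq_zero_iff hγ N q).2 (Ideal.mem_span_singleton.1 hq)).comp
  ((isDistinguishedAt_omegaPoly N).algEquivQuotient.symm.toAlgHom.comp
    (Ideal.Quotient.mkₐ ℤ_[p] (Ideal.span {(omegaPoly p N : PowerSeries ℤ_[p])})))

omit hγ in
theorem algEquivQuotient_omegaPoly_mk (N : ℕ) (q : ℤ_[p][X]) :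
    (isDistinguishedAt_omegaPoly (p := p) N).algEquivQuotient (Ideal.Quotient.mk _ q) =
      Ideal.Quotient.mk _ (q : PowerSeries ℤ_[p]) := by
  rw [Polynomial.IsDistinguishedAt.algEquivQuotient_apply]
  simp

/-- The working description of `seriesHom`: any polynomial congruent to `f` modulo `ω_N` computes
it. -/
theorem seriesHom_eq {N : ℕ} {f : PowerSeries ℤ_[p]} {q : ℤ_[p][X]}
    (h : (omegaPoly p N : PowerSeries ℤ_[p]) ∣ f - q) : seriesHom hγ N f = polyHom γ N q := by
  have h1 : Ideal.Quotient.mkₐ ℤ_[p] (Ideal.span {(omegaPoly p N : PowerSeries ℤ_[p])}) f =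
      (isDistinguishedAt_omegaPoly N).algEquivQuotient (Ideal.Quotient.mk _ q) := by
    rw [algEquivQuotient_omegaPoly_mk]
    exact Ideal.Quotient.eq.2 (Ideal.mem_span_singleton.2 h)
  have h2 : (isDistinguishedAt_omegaPoly N).algEquivQuotient.symm (Ideal.Quotient.mkₐ ℤ_[p]
      (Ideal.span {(omegaPoly p N : PowerSeries ℤ_[p])}) f) = Ideal.Quotient.mk _ q := by
    rw [h1, AlgEquiv.symm_apply_apply]
  exact congrArg (Ideal.Quotient.liftₐ (Ideal.span {omegaPoly p N}) (polyHom γ N) fun q hq =>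
    (polyHom_eq_zero_iff hγ N q).2 (Ideal.mem_span_singleton.1 hq)) h2

omit hγ in
theorem exists_omegaPoly_dvd_sub (N : ℕ) (f : PowerSeries ℤ_[p]) :
    ∃ q : ℤ_[p][X], (omegaPoly p N : PowerSeries ℤ_[p]) ∣ f - q := by
  obtain ⟨q, hq⟩ := Ideal.Quotient.mk_surjective
    ((isDistinguishedAt_omegaPoly (p := p) N).algEquivQuotient.symm (Ideal.Quotient.mk _ f))
  refine ⟨q, ?_⟩
  rw [AlgEquiv.eq_symm_apply, algEquivQuotient_omegaPoly_mk, eq_comm] at hq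
  exact Ideal.mem_span_singleton.1 (Ideal.Quotient.eq.1 hq)

theorem seriesHom_eq_zero {N : ℕ} {f : PowerSeries ℤ_[p]} (hf : seriesHom hγ N f = 0) :
    (omegaPoly p N : PowerSeries ℤ_[p]) ∣ f := by
  obtain ⟨q, hq⟩ := exists_omegaPoly_dvd_sub N f
  rw [seriesHom_eq hγ hq, polyHom_eq_zero_iff hγ] at hf
  obtain ⟨t, rfl⟩ := hf
  rw [Polynomial.coe_mul] at hq
  exact (dvd_sub_left (dvd_mul_right _ _)).1 hq

theorem levelMap_seriesHom {N M : ℕ} (hNM : N ≤ M) (h : gamLevel p M ≤ gamLevel p N)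
    (f : PowerSeries ℤ_[p]) :
    levelMap p (Gam p) h (seriesHom hγ M f) = seriesHom hγ N f := by
  obtain ⟨q, hq⟩ := exists_omegaPoly_dvd_sub M f
  obtain ⟨t, ht⟩ := omegaPoly_dvd (p := p) hNM
  have hq' : (omegaPoly p N : PowerSeries ℤ_[p]) ∣ f - q := by
    refine dvd_trans ?_ hq
    rw [ht, Polynomial.coe_mul]
    exact dvd_mul_right _ _
  rw [seriesHom_eq hγ hq, seriesHom_eq hγ hq', levelMap_polyHom]

omit hγ in
theorem gamLevel_le_of_le {N M : ℕ} (h : N ≤ M) : gamLevel p M ≤ gamLevel p N :=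
  fun _ hx => (pow_dvd_pow _ h).trans hx

omit hγ in
theorem levelMap_levelMap {G : Type*} [Group G] [TopologicalSpace G] {U V W : OpenNormalSubgroup G}
    (h : U ≤ V) (h' : V ≤ W) (x : MonoidAlgebra ℤ_[p] (G ⧸ (U : Subgroup G))) :
    levelMap p G h' (levelMap p G h x) = levelMap p G (h.trans h') x := by
  rw [← AlgHom.comp_apply, levelMap, levelMap, ← MonoidAlgebra.mapDomainAlgHom_comp]
  congr 2
  ext g
  rfl

/-- The homomorphism `ℤ_p[[T]] → ℤ_p[[Γ]]` with `T ↦ γ - 1`. -/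
def iwasawaHom : PowerSeries ℤ_[p] →ₐ[ℤ_[p]] CompletedGroupAlgebra p (Gam p) :=
  AlgHom.codRestrict
    (AlgHom.pi fun U : OpenNormalSubgroup (Gam p) =>
      (levelMap p (Gam p) (exists_gamLevel_le U).choose_spec).comp (seriesHom hγ _))
    (completedSubalgebra p (Gam p)) (by
      intro f U V h
      change levelMap p (Gam p) h (levelMap p (Gam p) _ (seriesHom hγ _ f)) =
        levelMap p (Gam p) _ (seriesHom hγ _ f)
      -- The levels chosen below `U` and `V` are unrelated; both are compared with their maximum.
      rw [levelMap_levelMap,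
        ← levelMap_seriesHom hγ (le_max_left (exists_gamLevel_le U).choose
          (exists_gamLevel_le V).choose) (gamLevel_le_of_le (le_max_left _ _)),
        ← levelMap_seriesHom hγ (le_max_right (exists_gamLevel_le U).choose
          (exists_gamLevel_le V).choose) (gamLevel_le_of_le (le_max_right _ _)),
        levelMap_levelMap, levelMap_levelMap])

open scoped PowerSeries.WithPiTopology in
-- The solutions at level `N` form a nonempty translate of the ideal `(ω_N)`, closed as a continuous
-- image of the compact space `ℤ_p[[T]]`. These sets are nested, so they have a common point.
theorem iwasawaHom_surjective : Function.Surjective (iwasawaHom hγ) := by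
  intro x
  have hcomp : CompactSpace (PowerSeries ℤ_[p]) :=
    inferInstanceAs (CompactSpace ((Unit →₀ ℕ) → ℤ_[p]))
  let S : ℕ → Set (PowerSeries ℤ_[p]) := fun N =>
    {f | seriesHom hγ N f = proj p (Gam p) (gamLevel p N) x}
  have hx : ∀ {N M : ℕ} (h : N ≤ M), levelMap p (Gam p) (gamLevel_le_of_le h)
      (proj p (Gam p) (gamLevel p M) x) = proj p (Gam p) (gamLevel p N) x :=
    fun h => x.2 _ _ (gamLevel_le_of_le h)
  have hne : ∀ N, (S N).Nonempty := by
    intro N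
    obtain ⟨q, hq⟩ := polyHom_surjective hγ N (proj p (Gam p) (gamLevel p N) x)
    refine ⟨q, ?_⟩
    change seriesHom hγ N q = _
    rw [seriesHom_eq hγ (q := q) (by simp), hq]
  have hcl : ∀ N, IsClosed (S N) := by
    intro N
    obtain ⟨f, hf⟩ := hne N
    have h : S N = Set.range fun t : PowerSeries ℤ_[p] => f + (omegaPoly p N : PowerSeries ℤ_[p]) * t := by
      ext g
      constructor
      · intro hg
        have h0 : seriesHom hγ N (g - f) = 0 := by
          rw [map_sub, show seriesHom hγ N g = _ from hg, show seriesHom hγ N f = _ from hf, sub_self]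
        obtain ⟨t, ht⟩ := seriesHom_eq_zero hγ h0
        exact ⟨t, by simp [← ht]⟩
      · rintro ⟨t, rfl⟩
        change seriesHom hγ N (f + _) = _
        rw [map_add, show seriesHom hγ N f = _ from hf,
          seriesHom_eq hγ (f := (omegaPoly p N : PowerSeries ℤ_[p]) * t) (q := 0) (by simp), map_zero,
          add_zero]
    rw [h]
    exact (isCompact_range (continuous_const.add (continuous_const.mul continuous_id))).isClosed
  have hanti : ∀ N, S (N + 1) ⊆ S N := by
    intro N f hf
    change seriesHom hγ N f = _
    rw [← levelMap_seriesHom hγ (Nat.le_succ N) (gamLevel_le_of_le (Nat.le_succ N)),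
      show seriesHom hγ (N + 1) f = _ from hf, hx (Nat.le_succ N)]
  obtain ⟨f, hf⟩ := IsCompact.nonempty_iInter_of_sequence_nonempty_isCompact_isClosed S hanti hne
    (hcl 0).isCompact hcl
  refine ⟨f, ext_proj fun U => ?_⟩
  change levelMap p (Gam p) (exists_gamLevel_le U).choose_spec (seriesHom hγ _ f) = _
  rw [show seriesHom hγ _ f = _ from Set.mem_iInter.1 hf _]
  exact x.2 _ _ _

end Iwasawa

/-! ### Separating functionals after base change to `ℚ̄_p` -/

section BaseChange

variable {p : ℕ} [Fact p.Prime] {N : Type*} [AddCommGroup N] [Module ℤ_[p] N]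

instance : Algebra.IsAlgebraic ℤ_[p] (PadicAlgCl p) :=
  (IsFractionRing.comap_isAlgebraic_iff (A := ℤ_[p]) (K := ℚ_[p]) (C := PadicAlgCl p)).2 inferInstance

instance : FaithfulSMul ℤ_[p] (PadicAlgCl p) := by
  rw [faithfulSMul_iff_algebraMap_injective, IsScalarTower.algebraMap_eq ℤ_[p] ℚ_[p] (PadicAlgCl p)]
  exact (algebraMap ℚ_[p] (PadicAlgCl p)).injective.comp Subtype.val_injective

/-- The left factors span a finitely generated torsion-free module over the PID `ℤ_p`; this is free,
and the tensor is rewritten in a basis of it. -/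
theorem exists_linearIndependent_sum_tmul (x : PadicAlgCl p ⊗[ℤ_[p]] N) :
    ∃ (d : ℕ) (e : Fin d → PadicAlgCl p) (y : Fin d → N), LinearIndependent ℤ_[p] e ∧
      x = ∑ i, e i ⊗ₜ[ℤ_[p]] y i := by
  obtain ⟨S, rfl⟩ := TensorProduct.exists_finset x
  let P : Submodule ℤ_[p] (PadicAlgCl p) := Submodule.span ℤ_[p] (Prod.fst '' (S : Set (PadicAlgCl p × N)))
  have hfin : Module.Finite ℤ_[p] P := Module.Finite.span_of_finite _ (S.finite_toSet.image _)
  have hmem : ∀ i ∈ S, i.1 ∈ P := fun i hi => Submodule.subset_span ⟨i, hi, rfl⟩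
  let b := Module.finBasis ℤ_[p] P
  refine ⟨_, fun j => b j, fun j => ∑ i : S, b.repr ⟨i.1.1, hmem _ i.2⟩ j • i.1.2,
    b.linearIndependent.map' P.subtype P.ker_subtype, ?_⟩
  simp only [TensorProduct.tmul_sum]
  rw [Finset.sum_comm, ← Finset.sum_coe_sort S]
  refine Finset.sum_congr rfl fun i _ => ?_
  have h := congrArg P.subtype (b.sum_repr ⟨i.1.1, hmem _ i.2⟩)
  rw [map_sum] at h
  simp only [TensorProduct.tmul_smul, TensorProduct.smul_tmul']
  rw [← TensorProduct.sum_tmul]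
  congr 1
  exact h.symm

/-- Functionals that separate the points of a `ℤ_p`-module `N` separate the points of
`ℚ̄_p ⊗ N`. -/
theorem eq_zero_of_liftBaseChange_eq_zero {ι : Type*} (f : ι → N →ₗ[ℤ_[p]] ℤ_[p])
    (hf : ∀ y, (∀ i, f i y = 0) → y = 0) {x : PadicAlgCl p ⊗[ℤ_[p]] N}
    (hx : ∀ i, LinearMap.liftBaseChange (PadicAlgCl p)
      ((Algebra.linearMap ℤ_[p] (PadicAlgCl p)).comp (f i)) x = 0) : x = 0 := by
  obtain ⟨d, e, y, he, rfl⟩ := exists_linearIndependent_sum_tmul x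
  refine Finset.sum_eq_zero fun j _ => ?_
  rw [hf (y j), TensorProduct.tmul_zero]
  intro i
  have h := hx i
  simp only [map_sum, LinearMap.liftBaseChange_tmul, LinearMap.comp_apply,
    Algebra.linearMap_apply, smul_eq_mul, mul_comm (e _), ← Algebra.smul_def] at h
  exact Fintype.linearIndependent_iff.1 he _ h j

end BaseChange

/-! ### `ℚ̄_p ⊗ ℤ_p[[Γ]]` is a principal ideal ring -/

section PrincipalIdeals

open Polynomial

variable {p : ℕ} [Fact p.Prime]

variable (p) in
/-- The homomorphism `ℚ̄_p ⊗ ℤ_p[[T]] → ℚ̄_p[[T]]`. -/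
def tensorToSeries : PadicAlgCl p ⊗[ℤ_[p]] PowerSeries ℤ_[p] →ₐ[ℤ_[p]] PowerSeries (PadicAlgCl p) :=
  Algebra.TensorProduct.lift (Algebra.ofId (PadicAlgCl p) (PowerSeries (PadicAlgCl p)) |>.restrictScalars ℤ_[p])
    (PowerSeries.mapAlgHom (Algebra.ofId ℤ_[p] (PadicAlgCl p))) fun _ _ => Commute.all _ _

/-- Coefficient functionals separate power series over `ℤ_p`, hence also tensors. The tensor product
is therefore a domain. -/
theorem tensorToSeries_injective : Function.Injective (tensorToSeries p) := by
  rw [injective_iff_map_eq_zero]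
  intro x hx
  refine eq_zero_of_liftBaseChange_eq_zero (fun n => PowerSeries.coeff (R := ℤ_[p]) n)
    (fun y hy => PowerSeries.ext hy) fun n => ?_
  have h := congrArg (PowerSeries.coeff n) hx
  rw [map_zero] at h
  rw [← h]
  clear hx h
  induction x using TensorProduct.induction_on with
  | zero => simp
  | add x y hx hy => rw [map_add, map_add, map_add, hx, hy]
  | tmul e f =>
    simp only [tensorToSeries, LinearMap.liftBaseChange_tmul, Algebra.TensorProduct.lift_tmul,
      LinearMap.comp_apply, Algebra.linearMap_apply, smul_eq_mul]
    exact (PowerSeries.coeff_C_mul n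
      (PowerSeries.map (algebraMap ℤ_[p] (PadicAlgCl p)) f) e).symm

instance : IsDomain (PadicAlgCl p ⊗[ℤ_[p]] PowerSeries ℤ_[p]) :=
  tensorToSeries_injective.isDomain (tensorToSeries p).toRingHom

/-- The tensor product is algebraic over `ℤ_p[[T]]` because `ℚ̄_p` is algebraic over `ℤ_p`, and a
nonzero algebraic element of a domain divides a nonzero element of the base. -/
theorem exists_dvd_one_tmul {x : PadicAlgCl p ⊗[ℤ_[p]] PowerSeries ℤ_[p]} (hx : x ≠ 0) :
    ∃ f : PowerSeries ℤ_[p], f ≠ 0 ∧ x ∣ 1 ⊗ₜ f := by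
  let c := Algebra.TensorProduct.comm ℤ_[p] (PadicAlgCl p) (PowerSeries ℤ_[p])
  have hd : IsDomain (PowerSeries ℤ_[p] ⊗[ℤ_[p]] PadicAlgCl p) := c.symm.toMulEquiv.isDomain _
  have hz : FaithfulSMul ℤ_[p] (PowerSeries ℤ_[p]) := by
    rw [faithfulSMul_iff_algebraMap_injective]
    intro x y h
    exact PowerSeries.C_injective (by simpa [PowerSeries.algebraMap_apply] using h)
  obtain ⟨f, hf, hxf⟩ := (Algebra.IsAlgebraic.isAlgebraic (R := PowerSeries ℤ_[p])
    (c x)).exists_nonzero_dvd (mem_nonZeroDivisors_of_ne_zero (by simpa using hx))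
  refine ⟨f, hf, ?_⟩
  have := map_dvd c.symm hxf
  simpa [c] using this

/-- Once the maximal power of `p` is removed, some coefficient is a unit, as Weierstrass preparation
requires. -/
theorem exists_eq_pow_mul_map_residue_ne_zero {f : PowerSeries ℤ_[p]} (hf : f ≠ 0) :
    ∃ (k : ℕ) (g : PowerSeries ℤ_[p]), f = PowerSeries.C (p : ℤ_[p]) ^ k * g ∧
      g.map (IsLocalRing.residue ℤ_[p]) ≠ 0 := by
  have hu : ¬ IsUnit (PowerSeries.C (p : ℤ_[p])) := by
    intro h
    have := h.map (PowerSeries.constantCoeff (R := ℤ_[p]))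
    rw [PowerSeries.constantCoeff_C] at this
    exact PadicInt.prime_p.not_isUnit this
  obtain ⟨k, g, hg, hfg⟩ := WfDvdMonoid.max_power_factor' hf hu
  refine ⟨k, g, hfg, fun h => hg ?_⟩
  have hc : ∀ n, (p : ℤ_[p]) ∣ PowerSeries.coeff n g := by
    intro n
    have h1 := congrArg (PowerSeries.coeff n) h
    rw [PowerSeries.coeff_map, map_zero, IsLocalRing.residue_eq_zero_iff,
      PadicInt.maximalIdeal_eq_span_p, Ideal.mem_span_singleton] at h1
    exact h1
  choose q hq using hc
  refine ⟨PowerSeries.mk q, PowerSeries.ext fun n => ?_⟩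
  rw [PowerSeries.coeff_C_mul, PowerSeries.coeff_mk, hq]

variable (p) in
/-- The homomorphism `ℚ̄_p[T] → ℚ̄_p ⊗ ℤ_p[[T]]`. -/
def polyToTensor : (PadicAlgCl p)[X] →ₐ[PadicAlgCl p] PadicAlgCl p ⊗[ℤ_[p]] PowerSeries ℤ_[p] :=
  aeval (1 ⊗ₜ PowerSeries.X)

theorem polyToTensor_map (r : ℤ_[p][X]) :
    polyToTensor p (r.map (algebraMap ℤ_[p] (PadicAlgCl p))) = 1 ⊗ₜ (r : PowerSeries ℤ_[p]) := by
  rw [polyToTensor, aeval_map_algebraMap]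
  have h : (aeval (1 ⊗ₜ PowerSeries.X) : ℤ_[p][X] →ₐ[ℤ_[p]]
      PadicAlgCl p ⊗[ℤ_[p]] PowerSeries ℤ_[p]) =
      Algebra.TensorProduct.includeRight.comp (Polynomial.coeToPowerSeries.algHom ℤ_[p]) := by
    refine Polynomial.algHom_ext ?_
    simp
  rw [h]
  simp

/-- A nonzero ideal contains a Weierstrass polynomial `P`. By division every element is a polynomial
over `ℚ̄_p` modulo `P`, so the ideal is generated by its preimage in the PID `ℚ̄_p[T]`. -/
instance : IsPrincipalIdealRing (PadicAlgCl p ⊗[ℤ_[p]] PowerSeries ℤ_[p]) where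
  principal I := by
    by_cases hI : I = ⊥
    · rw [hI]
      infer_instance
    obtain ⟨x, hxI, hx⟩ := Submodule.exists_mem_ne_zero_of_ne_bot hI
    obtain ⟨f, hf, hxf⟩ := exists_dvd_one_tmul hx
    obtain ⟨k, g, rfl, hg⟩ := exists_eq_pow_mul_map_residue_ne_zero hf
    obtain ⟨P, u, -, hu, hgPu⟩ := PowerSeries.exists_isWeierstrassFactorization hg
    have hp0 : (p : PadicAlgCl p) ≠ 0 := by
      rw [← map_natCast (algebraMap ℚ_[p] (PadicAlgCl p))]
      simpa using (Fact.out : p.Prime).ne_zero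
    -- The factor `p ^ k` is invertible in `ℚ̄_p`.
    have hgI : (1 : PadicAlgCl p) ⊗ₜ[ℤ_[p]] g ∈ I := by
      have h : (1 : PadicAlgCl p) ⊗ₜ[ℤ_[p]] g = (((p : PadicAlgCl p) ^ k)⁻¹ ⊗ₜ 1) *
          (1 ⊗ₜ (PowerSeries.C (p : ℤ_[p]) ^ k * g)) := by
        have h1 : PowerSeries.C (p : ℤ_[p]) ^ k * g = ((p : ℤ_[p]) ^ k) • g := by
          rw [← map_pow, PowerSeries.smul_eq_C_mul]
        rw [h1, Algebra.TensorProduct.tmul_mul_tmul, one_mul, mul_one, TensorProduct.tmul_smul,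
          TensorProduct.smul_tmul', Algebra.smul_def, map_pow, map_natCast,
          mul_inv_cancel₀ (pow_ne_zero k hp0)]
      rw [h]
      exact I.mul_mem_left _ (I.mem_of_dvd hxf hxI)
    have hPI : polyToTensor p (P.map (algebraMap ℤ_[p] (PadicAlgCl p))) ∈ I := by
      obtain ⟨v, hv⟩ := hu.exists_right_inv
      have h : (1 : PadicAlgCl p) ⊗ₜ[ℤ_[p]] (P : PowerSeries ℤ_[p]) = (1 ⊗ₜ g) * (1 ⊗ₜ v) := by
        rw [Algebra.TensorProduct.tmul_mul_tmul, hgPu, mul_assoc, hv, mul_one, mul_one]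
      rw [polyToTensor_map, h]
      exact I.mul_mem_right _ hgI
    obtain ⟨h, hJ⟩ := IsPrincipalIdealRing.principal (I.comap (polyToTensor p))
    have hJ' : ∀ t, polyToTensor p t ∈ I ↔ h ∣ t := by
      intro t
      rw [← Ideal.mem_span_singleton]
      change t ∈ I.comap (polyToTensor p) ↔ _
      rw [hJ]
    have hdiv : ∀ y : PadicAlgCl p ⊗[ℤ_[p]] PowerSeries ℤ_[p],
        ∃ s t, y = polyToTensor p (P.map (algebraMap ℤ_[p] (PadicAlgCl p))) * s + polyToTensor p t := by
      intro y
      induction y using TensorProduct.induction_on with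
      | zero => exact ⟨0, 0, by simp⟩
      | add y z hy hz =>
        obtain ⟨s, t, rfl⟩ := hy
        obtain ⟨s', t', rfl⟩ := hz
        exact ⟨s + s', t + t', by rw [map_add]; ring⟩
      | tmul e b =>
        obtain ⟨q, r, hqr⟩ := PowerSeries.exists_isWeierstrassDivision b hg
        refine ⟨e ⊗ₜ (u * q), C e * r.map (algebraMap ℤ_[p] (PadicAlgCl p)), ?_⟩
        rw [map_mul, polyToTensor_map, polyToTensor_map]
        have hC : polyToTensor p (C e) = e ⊗ₜ 1 := by
          rw [polyToTensor, aeval_C, Algebra.TensorProduct.algebraMap_apply]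
          rfl
        rw [hC, Algebra.TensorProduct.tmul_mul_tmul, Algebra.TensorProduct.tmul_mul_tmul, one_mul,
          one_mul, mul_one, ← TensorProduct.tmul_add, ← mul_assoc, ← hgPu, ← hqr.eq_mul_add]
    refine ⟨polyToTensor p h, le_antisymm (fun y hy => ?_) ?_⟩
    · obtain ⟨s, t, rfl⟩ := hdiv y
      have ht : polyToTensor p t ∈ I := (I.add_mem_iff_right (I.mul_mem_right _ hPI)).1 hy
      refine Ideal.mem_span_singleton.2 (dvd_add (Dvd.dvd.mul_right ?_ _) ?_)
      · exact map_dvd _ ((hJ' _).1 hPI)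
      · exact map_dvd _ ((hJ' _).1 ht)
    · rw [← Ideal.span, Ideal.span_singleton_le_iff_mem]
      exact (hJ' h).2 dvd_rfl

theorem isPrincipalIdealRing_extCompletedGroupAlgebra {γ : Gam p}
    (hγ : Dense (Subgroup.zpowers γ : Set (Gam p))) :
    IsPrincipalIdealRing (ExtCompletedGroupAlgebra p (Gam p)) :=
  IsPrincipalIdealRing.of_surjective
    (Algebra.TensorProduct.map (AlgHom.id ℤ_[p] (PadicAlgCl p)) (iwasawaHom hγ))
    (TensorProduct.map_surjective Function.surjective_id (iwasawaHom_surjective hγ))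

end PrincipalIdeals

/-! ### The extension of `φ̃` to `ℤ_p[[F_n]]` as a limit -/

section TensorRepCompleted

open CompletedGroupAlgebra FreeProP

variable {p : ℕ} [Fact p.Prime] {n ℓ : ℕ}

section Topology

variable {H : Type*} [CommGroup H] [TopologicalSpace H]

theorem extCoeffAt_tmul (U : OpenNormalSubgroup H) (c : H ⧸ (U : Subgroup H)) (e : PadicAlgCl p)
    (x : CompletedGroupAlgebra p H) :
    extCoeffAt p H U c (e ⊗ₜ x) = e * algebraMap ℤ_[p] (PadicAlgCl p) (coeffAt p H U c x) := by
  rw [extCoeffAt, LinearMap.liftBaseChange_tmul, smul_eq_mul]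
  rfl

theorem tendsto_nhds_iff_extCoeffAt {ι : Type*} {l : Filter ι} {f : ι → ExtCompletedGroupAlgebra p H}
    {y : ExtCompletedGroupAlgebra p H} : Tendsto f l (𝓝 y) ↔
      ∀ U c, Tendsto (fun i => extCoeffAt p H U c (f i)) l (𝓝 (extCoeffAt p H U c y)) := by
  rw [nhds_induced, tendsto_comap_iff, tendsto_pi_nhds]
  exact ⟨fun h U c => h ⟨U, c⟩, fun h q => h q.1 q.2⟩

instance : T2Space (ExtCompletedGroupAlgebra p H) := by
  refine (IsEmbedding.mk ⟨rfl⟩ fun x y h => ?_ : IsEmbedding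
    (fun (y : ExtCompletedGroupAlgebra p H) (q : Σ U : OpenNormalSubgroup H, H ⧸ (U : Subgroup H)) =>
      extCoeffAt p H q.1 q.2 y)).t2Space
  rw [← sub_eq_zero]
  refine eq_zero_of_liftBaseChange_eq_zero
    (fun q : Σ U : OpenNormalSubgroup H, H ⧸ (U : Subgroup H) => coeffAt p H q.1 q.2)
    (fun z hz => ext_coeffAt fun U c => by rw [hz ⟨U, c⟩, map_zero]) fun q => ?_
  change extCoeffAt p H q.1 q.2 (x - y) = 0
  rw [map_sub, sub_eq_zero]
  exact congrFun h q

theorem tendsto_sum_tmul {ι κ : Type*} {l : Filter ι} {S : Finset κ} (e : κ → PadicAlgCl p)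
    {f : κ → ι → CompletedGroupAlgebra p H} {y : κ → CompletedGroupAlgebra p H}
    (h : ∀ k ∈ S, Tendsto (f k) l (𝓝 (y k))) :
    Tendsto (fun i => ∑ k ∈ S, (e k ⊗ₜ f k i : ExtCompletedGroupAlgebra p H)) l
      (𝓝 (∑ k ∈ S, e k ⊗ₜ y k)) := by
  rw [tendsto_nhds_iff_extCoeffAt]
  intro U c
  simp only [map_sum, extCoeffAt_tmul]
  refine tendsto_finsetSum _ fun k hk => Tendsto.const_mul _ ?_
  exact (continuous_algebraMap_padicAlgCl.tendsto _).comp (tendsto_nhds_iff_coeffAt.1 (h k hk) U c)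

end Topology

section Coordinates

theorem isClosed_intermediateField (E : IntermediateField ℚ_[p] (PadicAlgCl p))
    [FiniteDimensional ℚ_[p] E] : IsClosed (E : Set (PadicAlgCl p)) := by
  have : FiniteDimensional ℚ_[p] (Subalgebra.toSubmodule E.toSubalgebra) :=
    inferInstanceAs (FiniteDimensional ℚ_[p] E)
  exact (Subalgebra.toSubmodule E.toSubalgebra).closed_of_finiteDimensional

/-- A continuous representation of a free pro-`p` group is defined over a finite extension
of `ℚ_p`. -/
theorem exists_finiteDimensional_forall_mem (φ : FreeProP p n →ₜ* GL (Fin ℓ) (PadicAlgCl p)) :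
    ∃ E : IntermediateField ℚ_[p] (PadicAlgCl p), FiniteDimensional ℚ_[p] E ∧
      ∀ x s t, (φ x).1 s t ∈ E := by
  -- Including the entries at the inverse generators lets induction over words use only sums and
  -- products.
  let S : Set (PadicAlgCl p) := Set.range (fun q : Fin n × Fin ℓ × Fin ℓ =>
    (φ (gen p n q.1)).1 q.2.1 q.2.2) ∪ Set.range (fun q : Fin n × Fin ℓ × Fin ℓ =>
    (φ (gen p n q.1)⁻¹).1 q.2.1 q.2.2)
  have hS : Finite S := Set.Finite.to_subtype ((Set.finite_range _).union (Set.finite_range _))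
  let E := IntermediateField.adjoin ℚ_[p] S
  have hE : FiniteDimensional ℚ_[p] E :=
    IntermediateField.finiteDimensional_adjoin fun x _ => Algebra.IsIntegral.isIntegral x
  refine ⟨E, hE, fun x s t => ?_⟩
  have hF : ∀ w s t, (φ (ofFreeGroup p n w)).1 s t ∈ E := by
    intro w
    induction w using FreeGroup.induction_on with
    | C1 =>
      intro s t
      rw [map_one, map_one, Units.val_one, Matrix.one_apply]
      split_ifs
      · exact E.one_mem
      · exact E.zero_mem
    | of i =>
      exact fun s t => IntermediateField.subset_adjoin _ _ (Or.inl ⟨(i, s, t), rfl⟩)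
    | inv_of i _ =>
      rw [map_inv]
      exact fun s t => IntermediateField.subset_adjoin _ _ (Or.inr ⟨(i, s, t), rfl⟩)
    | mul v w hv hw =>
      intro s t
      rw [map_mul, map_mul, Units.val_mul, Matrix.mul_apply]
      exact sum_mem fun u _ => mul_mem (hv s u) (hw u t)
  have hcont : Continuous fun x => (φ x).1 s t :=
    (Units.continuous_val.comp φ.continuous_toFun).matrix_elem s t
  -- `E` is closed, being finite-dimensional over the complete field `ℚ_p`, and words are dense.
  exact denseRange_ofFreeGroup.induction_on (p := fun x => (φ x).1 s t ∈ E) x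
    ((isClosed_intermediateField E).preimage hcont) fun w => hF w s t

/-- A continuous function on a compact space with values in a finite extension of `ℚ_p` is a
combination of continuous functions with values in `ℤ_p`. -/
theorem exists_eq_sum_mul_algebraMap {X : Type*} [TopologicalSpace X] [CompactSpace X]
    {E : IntermediateField ℚ_[p] (PadicAlgCl p)} [FiniteDimensional ℚ_[p] E]
    {f : X → PadicAlgCl p} (hf : Continuous f) (hE : ∀ x, f x ∈ E) :
    ∃ (d : ℕ) (e : Fin d → PadicAlgCl p) (h : Fin d → X → ℤ_[p]), (∀ k, Continuous (h k)) ∧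
      ∀ x, f x = ∑ k, e k * algebraMap ℤ_[p] (PadicAlgCl p) (h k x) := by
  let b := Module.finBasis ℚ_[p] E
  let g : Fin (Module.finrank ℚ_[p] E) → X → ℚ_[p] := fun k x => b.coord k ⟨f x, hE x⟩
  have hg : ∀ k, Continuous (g k) := fun k =>
    (LinearMap.continuous_of_finiteDimensional (b.coord k)).comp (hf.subtype_mk hE)
  -- Compactness bounds the coordinates, so one power of `p` clears all denominators; the basis
  -- vectors absorb its inverse.
  have hbd : ∀ k, ∃ K : ℕ, ∀ x, ‖(p : ℚ_[p]) ^ K * g k x‖ ≤ 1 := by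
    intro k
    obtain ⟨C, hC⟩ := isCompact_univ.exists_bound_of_continuousOn (hg k).continuousOn
    have hp1 : (1 : ℝ) < p := by exact_mod_cast (Fact.out : p.Prime).one_lt
    obtain ⟨K, hK⟩ := pow_unbounded_of_one_lt C hp1
    refine ⟨K, fun x => ?_⟩
    have hpos : (0 : ℝ) < p ^ K := pow_pos (zero_lt_one.trans hp1) K
    rw [norm_mul, norm_pow, Padic.norm_p, inv_pow, inv_mul_le_one₀ hpos]
    exact (hC x (Set.mem_univ x)).trans hK.le
  choose K hK using hbd
  have hp0 : (p : PadicAlgCl p) ≠ 0 := by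
    rw [← map_natCast (algebraMap ℚ_[p] (PadicAlgCl p))]
    simpa using (Fact.out : p.Prime).ne_zero
  refine ⟨_, fun k => ((p : PadicAlgCl p) ^ K k)⁻¹ * b k, fun k x => ⟨_, hK k x⟩, fun k => ?_,
    fun x => ?_⟩
  · exact (continuous_const.mul (hg k)).subtype_mk _
  · have h := congrArg E.val.toLinearMap (b.sum_repr ⟨f x, hE x⟩)
    rw [map_sum] at h
    refine h.symm.trans (Finset.sum_congr rfl fun k _ => ?_)
    have h1 : algebraMap ℤ_[p] (PadicAlgCl p) ⟨(p : ℚ_[p]) ^ K k * g k x, hK k x⟩ =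
        (p : PadicAlgCl p) ^ K k * algebraMap ℚ_[p] (PadicAlgCl p) (g k x) :=
      (IsScalarTower.algebraMap_apply ℤ_[p] ℚ_[p] (PadicAlgCl p) ⟨_, hK k x⟩).trans
        ((map_mul (algebraMap ℚ_[p] (PadicAlgCl p)) ((p : ℚ_[p]) ^ K k) (g k x)).trans
          (by rw [map_pow, map_natCast]))
    rw [h1, map_smul, Algebra.smul_def]
    change algebraMap ℚ_[p] (PadicAlgCl p) (g k x) * (b k : PadicAlgCl p) = _
    have h2 : (p : PadicAlgCl p) ^ K k ≠ 0 := pow_ne_zero _ hp0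
    field_simp

end Coordinates

variable {H : Type*} [CommGroup H] [TopologicalSpace H]

/-- The linear extension of `x ↦ h(x) ψ(x)` to the group algebra, with values in `ℤ_p[[H]]`. -/
def weightedSum (h : FreeProP p n → ℤ_[p]) (ψ : FreeProP p n →ₜ* H)
    (z : MonoidAlgebra ℤ_[p] (FreeProP p n)) : CompletedGroupAlgebra p H :=
  Finsupp.linearCombination ℤ_[p] (fun x => h x • of p H (ψ x)) z.coeff

/-- The `e k` do not depend on `z`, so limits in `ℚ̄_p ⊗ ℤ_p[[H]]` reduce to limits in `ℤ_p[[H]]`,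
where compactness is available. -/
theorem exists_entry_eq_sum_tmul (φ : FreeProP p n →ₜ* GL (Fin ℓ) (PadicAlgCl p))
    (ψ : FreeProP p n →ₜ* H) (s t : Fin ℓ) :
    ∃ (d : ℕ) (e : Fin d → PadicAlgCl p) (h : Fin d → FreeProP p n → ℤ_[p]),
      (∀ k, Continuous (h k)) ∧ ∀ z : MonoidAlgebra ℤ_[p] (FreeProP p n),
        Finsupp.linearCombination ℤ_[p] (fun x => (tensorRep φ ψ x).1) z.coeff s t =
          ∑ k, e k ⊗ₜ weightedSum (h k) ψ z := by
  obtain ⟨E, hE, hφ⟩ := exists_finiteDimensional_forall_mem φ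
  have hcont : Continuous fun x => (φ x).1 s t :=
    (Units.continuous_val.comp φ.continuous_toFun).matrix_elem s t
  obtain ⟨d, e, h, hh, hsum⟩ := exists_eq_sum_mul_algebraMap hcont fun x => hφ x s t
  refine ⟨d, e, h, hh, fun z => ?_⟩
  simp only [weightedSum, Finsupp.linearCombination_apply, Finsupp.sum, TensorProduct.tmul_sum]
  rw [Finset.sum_comm, Matrix.sum_apply]
  refine Finset.sum_congr rfl fun x _ => ?_
  have h1 : (tensorRep φ ψ x).1 s t = (φ x).1 s t ⊗ₜ of p H (ψ x) := rfl
  rw [Matrix.smul_apply, h1, hsum, TensorProduct.sum_tmul, Finset.smul_sum]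
  refine Finset.sum_congr rfl fun k _ => ?_
  rw [TensorProduct.tmul_smul, TensorProduct.tmul_smul, mul_comm (e k), ← Algebra.smul_def]
  simp only [TensorProduct.smul_tmul']

variable [IsTopologicalGroup H] [CompactSpace H]

theorem exists_tendsto_weightedSum {h : FreeProP p n → ℤ_[p]} (hh : Continuous h)
    (ψ : FreeProP p n →ₜ* H) (x : CompletedGroupAlgebra p (FreeProP p n)) :
    ∃ y, Tendsto (weightedSum h ψ) (comap (ofGroupAlgebra p (FreeProP p n)) (𝓝 x)) (𝓝 y) := by
  rw [← ofHom_id]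
  refine exists_tendsto_linearCombination _ (denseRange_ofHom _ fun U c =>
    QuotientGroup.mk_surjective c) (fun V c s => exists_forall_pow_dvd_sub ?_ s) x
  simp only [map_smul, smul_eq_mul]
  exact hh.mul ((continuous_coeffAt V c).comp (continuous_of.comp ψ.continuous_toFun))

theorem exists_tensorRepCompleted_entry (φ : FreeProP p n →ₜ* GL (Fin ℓ) (PadicAlgCl p))
    (ψ : FreeProP p n →ₜ* H) (x : CompletedGroupAlgebra p (FreeProP p n)) (s t : Fin ℓ) :
    ∃ (d : ℕ) (e : Fin d → PadicAlgCl p)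
      (Y : Fin d → MonoidAlgebra ℤ_[p] (FreeProP p n) → CompletedGroupAlgebra p H)
      (y : Fin d → CompletedGroupAlgebra p H),
      (∀ k, Tendsto (Y k) (comap (ofGroupAlgebra p (FreeProP p n)) (𝓝 x)) (𝓝 (y k))) ∧
      (∀ z, Finsupp.linearCombination ℤ_[p] (fun x => (tensorRep φ ψ x).1) z.coeff s t =
          ∑ k, e k ⊗ₜ Y k z) ∧
      tensorRepCompleted φ ψ x s t = ∑ k, e k ⊗ₜ y k := by
  choose d e h hh hsum using exists_entry_eq_sum_tmul φ ψ
  choose y hy using fun s t k => exists_tendsto_weightedSum (hh s t k) ψ x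
  refine ⟨d s t, e s t, fun k => weightedSum (h s t k) ψ, y s t, hy s t, hsum s t, ?_⟩
  have hne : (comap (ofGroupAlgebra p (FreeProP p n)) (𝓝 x)).NeBot := by
    refine comap_neBot fun u hu => ?_
    have hd : DenseRange (ofHom (p := p) (MonoidHom.id (FreeProP p n))) :=
      denseRange_ofHom _ fun U c => QuotientGroup.mk_surjective c
    rw [ofHom_id] at hd
    obtain ⟨_, h, z, rfl⟩ := mem_closure_iff_nhds.1 (hd x) u hu
    exact ⟨z, h⟩
  have hlim : Tendsto (fun z : MonoidAlgebra ℤ_[p] (FreeProP p n) =>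
      Finsupp.linearCombination ℤ_[p] (fun x => (tensorRep φ ψ x).1) z.coeff)
      (comap (ofGroupAlgebra p (FreeProP p n)) (𝓝 x))
      (𝓝 (Matrix.of fun s t => ∑ k, e s t k ⊗ₜ y s t k)) := by
    refine tendsto_pi_nhds.2 fun s => tendsto_pi_nhds.2 fun t => ?_
    simp only [hsum]
    exact tendsto_sum_tmul _ fun k _ => hy s t k
  have := hlim.limUnder_eq
  exact congrFun (congrFun this s) t

/-- Continuity of `evalAt` in the coefficient topology is not used: with the left tensor factors
fixed, continuity of `evalCompleted` suffices. -/
theorem tendsto_evalAt_tensorRep (φ : FreeProP p n →ₜ* GL (Fin ℓ) (PadicAlgCl p))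
    (ψ : FreeProP p n →ₜ* Gam p) {γ : Gam p} (hγ : Dense (Subgroup.zpowers γ : Set (Gam p)))
    {a : PadicAlgCl p} (ha : ‖a - 1‖ < 1) (x : CompletedGroupAlgebra p (FreeProP p n))
    (s t : Fin ℓ) :
    Tendsto (fun z : MonoidAlgebra ℤ_[p] (FreeProP p n) => evalAt γ hγ a ha
      (Finsupp.linearCombination ℤ_[p] (fun x => (tensorRep φ ψ x).1) z.coeff s t))
      (comap (ofGroupAlgebra p (FreeProP p n)) (𝓝 x))
      (𝓝 (evalAt γ hγ a ha (tensorRepCompleted φ ψ x s t))) := by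
  obtain ⟨d, e, Y, y, hY, hz, hx⟩ := exists_tensorRepCompleted_entry φ ψ x s t
  simp only [hz, hx, map_sum, evalAt_tmul]
  exact tendsto_finsetSum _ fun k _ =>
    (((continuous_evalCompleted hγ ha).tendsto _).comp (hY k)).const_mul _

end TensorRepCompleted

/-! ### Cocycles and the rank of the specialized Fox matrix -/

section Cohomology

open CompletedGroupAlgebra FreeProP

variable {p : ℕ} [Fact p.Prime] {n ℓ : ℕ} {G : Type*} [Group G] [TopologicalSpace G]

/-- A crossed homomorphism on a free group vanishes if it vanishes on the free generators. -/
theorem FreeGroup.crossedHom_eq_zero {ι R V : Type*} [Ring R] [AddCommGroup V] [Module R V]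
    (A : FreeGroup ι →* R) {D : FreeGroup ι → V} (hD : ∀ v w, D (v * w) = D v + A v • D w)
    (h0 : ∀ i, D (FreeGroup.of i) = 0) (w : FreeGroup ι) : D w = 0 := by
  have h1 : D 1 = 0 := by simpa using hD 1 1
  induction w using FreeGroup.induction_on with
  | C1 => exact h1
  | of i => exact h0 i
  | inv_of i h =>
    have := hD (FreeGroup.of i)⁻¹ (FreeGroup.of i)
    rwa [inv_mul_cancel, h1, h, smul_zero, add_zero, eq_comm] at this
  | mul v w hv hw => rw [hD, hv, hw, smul_zero, add_zero]

/-- Both sides are crossed homomorphisms that agree on the free generators. -/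
theorem foxGroup_fundamental_formula {V : Type*} [AddCommGroup V] {R : Type*} [Ring R]
    [Algebra ℤ_[p] R] [Module R V] (A : MonoidAlgebra ℤ_[p] (FreeGroup (Fin n)) →ₐ[ℤ_[p]] R)
    {D : FreeGroup (Fin n) → V} (hD : ∀ v w, D (v * w) = D v + A (MonoidAlgebra.of _ _ v) • D w)
    (w : FreeGroup (Fin n)) : D w = ∑ i, A (foxGroup p n i w) • D (FreeGroup.of i) := by
  rw [← sub_eq_zero]
  refine FreeGroup.crossedHom_eq_zero ((A : _ →* R).comp (MonoidAlgebra.of ℤ_[p] (FreeGroup (Fin n))))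
    (D := fun w => D w - ∑ i, A (foxGroup p n i w) • D (FreeGroup.of i)) (fun v w => ?_)
    (fun j => ?_) w
  · simp only [hD, foxGroup_mul, map_add, map_mul, add_smul, mul_smul, Finset.sum_add_distrib,
      smul_sub, Finset.smul_sum, MonoidHom.comp_apply, MonoidHom.coe_coe]
    abel
  · simp [foxGroup_of, ite_smul]

/-- The extension of a matrix representation to the group algebra. -/
def repHom (ρ : G →ₜ* GL (Fin ℓ) (PadicAlgCl p)) (π : FreeProP p n →ₜ* G) :
    MonoidAlgebra ℤ_[p] (FreeProP p n) →ₐ[ℤ_[p]] Matrix (Fin ℓ) (Fin ℓ) (PadicAlgCl p) :=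
  MonoidAlgebra.lift ℤ_[p] _ _
    ((Units.coeHom _).comp ((ρ : G →* GL (Fin ℓ) (PadicAlgCl p)).comp (π : FreeProP p n →* G)))

theorem repHom_of (ρ : G →ₜ* GL (Fin ℓ) (PadicAlgCl p)) (π : FreeProP p n →ₜ* G)
    (x : FreeProP p n) : repHom ρ π (MonoidAlgebra.of _ _ x) = (ρ (π x)).1 := by
  rw [repHom, MonoidAlgebra.lift_of]
  rfl

variable {ρ : G →ₜ* GL (Fin ℓ) (PadicAlgCl p)} {π : FreeProP p n →ₜ* G}

theorem cocycle_eq_sum_foxGroup {β : G → Fin ℓ → PadicAlgCl p} (hβ : β ∈ oneCocycles ρ)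
    (w : FreeGroup (Fin n)) : β (π (ofFreeGroup p n w)) =
      ∑ i, Matrix.mulVec (repHom ρ π (MonoidAlgebra.mapDomainAlgHom ℤ_[p] ℤ_[p] (ofFreeGroup p n)
        (foxGroup p n i w))) (β (π (gen p n i))) := by
  have h := foxGroup_fundamental_formula
    (((Matrix.toLinAlgEquiv' (R := PadicAlgCl p) (n := Fin ℓ)).toAlgHom.restrictScalars ℤ_[p]).comp
      ((repHom ρ π).comp (MonoidAlgebra.mapDomainAlgHom ℤ_[p] ℤ_[p] (ofFreeGroup p n))))
    (D := fun w => β (π (ofFreeGroup p n w))) (fun v w => ?_) w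
  · exact h
  · rw [map_mul, map_mul, hβ.2]
    congr 1
    rw [← repHom_of]
    simp [Module.End.smul_def, Matrix.toLinAlgEquiv'_apply]

/-- The fundamental formula handles words, and continuity with density handles the rest. Hence
evaluation at the generators is injective on cocycles. -/
theorem cocycle_eq_zero (hπ : Function.Surjective π) {β : G → Fin ℓ → PadicAlgCl p}
    (hβ : β ∈ oneCocycles ρ) (h0 : ∀ i, β (π (gen p n i)) = 0) : β = 0 := by
  funext x
  obtain ⟨y, rfl⟩ := hπ x
  refine denseRange_ofFreeGroup.induction_on (p := fun y => β (π y) = 0) y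
    (isClosed_eq (hβ.1.comp π.continuous_toFun) continuous_const) fun w => ?_
  rw [cocycle_eq_sum_foxGroup hβ]
  simp [h0]

section Specialization

variable {γ : Gam p} (hγ : Dense (Subgroup.zpowers γ : Set (Gam p)))
  {a : PadicAlgCl p} (ha : ‖a - 1‖ < 1) {φ : FreeProP p n →ₜ* GL (Fin ℓ) (PadicAlgCl p)}
  {ψ : FreeProP p n →ₜ* Gam p}
  (hρ : ∀ x : FreeProP p n, (ρ (π x)).1 = (tensorRep φ ψ x).1.map (evalAt γ hγ a ha))

include hρ

theorem evalAt_linearCombination_tensorRep (z : MonoidAlgebra ℤ_[p] (FreeProP p n)) (s t : Fin ℓ) :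
    evalAt γ hγ a ha
      (Finsupp.linearCombination ℤ_[p] (fun x => (tensorRep φ ψ x).1) z.coeff s t) =
      repHom ρ π z s t := by
  rw [repHom, MonoidAlgebra.lift_apply, Finsupp.linearCombination_apply, Finsupp.sum, Finsupp.sum,
    Matrix.sum_apply, Matrix.sum_apply, map_sum]
  refine Finset.sum_congr rfl fun x _ => ?_
  rw [Matrix.smul_apply, Matrix.smul_apply, LinearMap.map_smul_of_tower]
  congr 1
  exact (congrFun (congrFun (hρ x) s) t).symm

/-- The values of a cocycle at the generators are killed by the specialized Fox matrix. -/
theorem foxMatrix_mulVec_cocycle {m : ℕ} {r : Fin m → FreeProP p n} (hr : ∀ j, π (r j) = 1)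
    {β : G → Fin ℓ → PadicAlgCl p} (hβ : β ∈ oneCocycles ρ) :
    Matrix.mulVec ((foxMatrix r φ ψ).map (evalAt γ hγ a ha)) (fun q => β (π (gen p n q.1)) q.2) =
      0 := by
  funext q
  obtain ⟨j, s⟩ := q
  have hne : (comap (ofFreeGroup p n) (𝓝 (r j))).NeBot := comap_neBot fun u hu => by
    obtain ⟨_, h, z, rfl⟩ := mem_closure_iff_nhds.1 (denseRange_ofFreeGroup (r j)) u hu
    exact ⟨z, h⟩
  -- As words `w` tend to `r j`, the limit of `β (π w)` is computed twice: by continuity it is `β 1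
  -- = 0`, by the fundamental formula it is a row of the matrix product.
  have h1 : Tendsto (fun w => β (π (ofFreeGroup p n w)) s) (comap (ofFreeGroup p n) (𝓝 (r j)))
      (𝓝 0) := by
    have hb : β 1 = 0 := by
      have := hβ.2 1 1
      simpa using this
    have hc : Continuous fun y => β (π y) s :=
      (continuous_apply s).comp (hβ.1.comp π.continuous_toFun)
    have := (hc.tendsto (r j)).comp (tendsto_comap (f := ofFreeGroup p n))
    rwa [hr, hb] at this
  have h2 : ∀ i, Tendsto (fun w => MonoidAlgebra.mapDomainAlgHom ℤ_[p] ℤ_[p] (ofFreeGroup p n)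
      (foxGroup p n i w)) (comap (ofFreeGroup p n) (𝓝 (r j)))
      (comap (ofGroupAlgebra p (FreeProP p n)) (𝓝 (foxDeriv p n i (of p (FreeProP p n) (r j))))) :=
    fun i => tendsto_comap_iff.2 (tendsto_foxGroup i (r j))
  have h3 : Tendsto (fun w => β (π (ofFreeGroup p n w)) s) (comap (ofFreeGroup p n) (𝓝 (r j)))
      (𝓝 (∑ i, ∑ t, evalAt γ hγ a ha (foxMatrix r φ ψ (j, s) (i, t)) * β (π (gen p n i)) t)) := by
    simp only [cocycle_eq_sum_foxGroup hβ, Finset.sum_apply, Matrix.mulVec, dotProduct,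
      ← evalAt_linearCombination_tensorRep hγ ha hρ]
    exact tendsto_finsetSum _ fun i _ => tendsto_finsetSum _ fun t _ =>
      ((tendsto_evalAt_tensorRep φ ψ hγ ha _ s t).comp (h2 i)).mul_const _
  rw [Matrix.mulVec, dotProduct, Fintype.sum_prod_type]
  exact (tendsto_nhds_unique h3 h1)

/-- If `H¹` is nonzero and there are no invariants, then the specialized Fox matrix has small
rank. -/
theorem rank_foxMatrix_lt {m : ℕ} {r : Fin m → FreeProP p n} (hπ : Function.Surjective π)
    (hr : ∀ j, π (r j) = 1)
    (hfix : ¬ ∃ v : Fin ℓ → PadicAlgCl p, v ≠ 0 ∧ ∀ x : G, Matrix.mulVec (ρ x).1 v = v)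
    (hH : Nontrivial (ContH1 ρ)) :
    ((foxMatrix r φ ψ).map (evalAt γ hγ a ha)).rank < n * ℓ - ℓ := by
  set Q := (foxMatrix r φ ψ).map (evalAt γ hγ a ha)
  let ev : oneCocycles ρ →ₗ[PadicAlgCl p] LinearMap.ker Q.mulVecLin :=
    { toFun := fun β => ⟨fun q => β.1 (π (gen p n q.1)) q.2,
        foxMatrix_mulVec_cocycle hγ ha hρ hr β.2⟩
      map_add' := fun _ _ => rfl
      map_smul' := fun _ _ => rfl }
  have hev : Function.Injective ev := by
    rw [← LinearMap.ker_eq_bot, LinearMap.ker_eq_bot']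
    intro β hβ
    refine Subtype.ext (cocycle_eq_zero hπ β.2 fun i => funext fun t => ?_)
    exact congrFun (congrArg Subtype.val hβ) (i, t)
  have hfin : FiniteDimensional (PadicAlgCl p) (oneCocycles ρ) :=
    FiniteDimensional.of_injective ev hev
  have hcob : Function.Injective (coboundaryMap ρ) := by
    rw [← LinearMap.ker_eq_bot, LinearMap.ker_eq_bot']
    intro v hv
    by_contra hv0
    exact hfix ⟨v, hv0, fun x => sub_eq_zero.1 (congrFun hv x)⟩
  have hlt : oneCoboundaries ρ < oneCocycles ρ := by
    refine lt_of_le_of_ne (oneCoboundaries_le ρ) fun h => ?_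
    rw [Submodule.Quotient.nontrivial_iff] at hH
    exact hH (Submodule.submoduleOf_eq_top.2 h.ge)
  -- The count is `ℓ = dim B¹ < dim Z¹ ≤ dim ker Q = nℓ - rank Q`. In particular `ℓ < nℓ`, so the
  -- truncated subtraction is harmless.
  have h1 := Submodule.finrank_lt_finrank_of_lt hlt
  rw [oneCoboundaries, LinearMap.finrank_range_of_inj hcob, Module.finrank_fin_fun] at h1
  have h2 := LinearMap.finrank_le_finrank_of_injective hev
  have h3 := Q.mulVecLin.finrank_range_add_finrank_ker
  rw [Module.finrank_fintype_fun_eq_card, Fintype.card_prod, Fintype.card_fin, Fintype.card_fin] at h3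
  rw [Matrix.rank]
  omega

end Specialization

end Cohomology

/-! ### Vanishing of the minors and of their gcd -/

theorem Matrix.det_submatrix_eq_zero_of_rank_lt {K ι κ : Type*} [Field K] [Fintype κ]
    {s : ℕ} (Q : Matrix ι κ K) (hQ : Q.rank < s) (f : Fin s → ι) (g : Fin s → κ) :
    (Q.submatrix f g).det = 0 := by
  by_contra h
  have := Matrix.rank_of_isUnit (Q.submatrix f g)
    ((Matrix.isUnit_iff_isUnit_det _).2 (isUnit_iff_ne_zero.2 h))
  rw [Fintype.card_fin] at this
  have h2 := Matrix.rank_submatrix_le Q f g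
  omega

theorem theorem4p2 (p : ℕ) [Fact p.Prime] {n m k : ℕ} (hk : 2 ≤ k)
    -- the pro-`p` group `G = ⟨g_1, …, g_n ∣ r_1 = ⋯ = r_m = 1⟩`
    {G : Type*} [Group G] [TopologicalSpace G] [IsTopologicalGroup G] [T2Space G]
    (r : Fin m → FreeProP p n) (π : FreeProP p n →ₜ* G) (hπ : IsProPPresentation r π)
    -- the surjection `α : G → Γ` with `α(g_i) = γ`
    (γ : Gam p) (hγ : Dense (Subgroup.zpowers γ : Set (Gam p)))
    (α : G →ₜ* Gam p) (hα : Function.Surjective α)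
    (hαγ : ∀ i, α (π (FreeProP.gen p n i)) = γ)
    -- the homomorphism `φ_{k-2}`, the number `a_{k-1}`, and the representation `ρ_{k-2}`
    (φ : FreeProP p n →ₜ* GL (Fin (k - 1)) (PadicAlgCl p))
    (a : PadicAlgCl p) (ha : ‖a - 1‖ < 1)
    (ρ : G →ₜ* GL (Fin (k - 1)) (PadicAlgCl p))
    (hρ : ∀ x : FreeProP p n,
      (ρ (π x) : Matrix (Fin (k - 1)) (Fin (k - 1)) (PadicAlgCl p)) =
        (tensorRep φ (α.comp π) x :
          Matrix (Fin (k - 1)) (Fin (k - 1)) (ExtCompletedGroupAlgebra p (Gam p))).map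
            (evalAt γ hγ a ha))
    -- no simultaneous eigenvector with simultaneous eigenvalue `1`
    (hfix : ¬ ∃ v : Fin (k - 1) → PadicAlgCl p, v ≠ 0 ∧ ∀ x : G,
      Matrix.mulVec (ρ x : Matrix (Fin (k - 1)) (Fin (k - 1)) (PadicAlgCl p)) v = v)
    (hH : Nontrivial (ContH1 ρ)) :
    (∃ Δ, IsTwistedAlexander r φ (α.comp π) (k - 1) Δ) ∧
      ∀ Δ, IsTwistedAlexander r φ (α.comp π) (k - 1) Δ → evalAt γ hγ a ha Δ = 0 := by
  have hr : ∀ j, π (r j) = 1 := by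
    intro j
    have h : r j ∈ (π : FreeProP p n →* G).ker := by
      rw [hπ.ker_eq]
      exact Subgroup.le_topologicalClosure _ (Subgroup.subset_normalClosure ⟨j, rfl⟩)
    exact h
  have hI : fittingIdeal r φ (α.comp π) (k - 1) ≤ RingHom.ker (evalAtHom hγ ha) := by
    rw [fittingIdeal, Ideal.span_le]
    rintro _ ⟨f, g, rfl⟩
    refine (RingHom.map_det _ _).trans ?_
    exact Matrix.det_submatrix_eq_zero_of_rank_lt _
      (rank_foxMatrix_lt hγ ha hρ hπ.surjective hr hfix hH) f g
  have := isPrincipalIdealRing_extCompletedGroupAlgebra hγ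
  -- A generator of the Fitting ideal is a gcd that belongs to the ideal, so it vanishes at `a`; any
  -- other gcd is a multiple of it.
  obtain ⟨h, hh⟩ := IsPrincipalIdealRing.principal (fittingIdeal r φ (α.comp π) (k - 1))
  have hdvd : ∀ x, x ∈ fittingIdeal r φ (α.comp π) (k - 1) ↔ h ∣ x := fun x => by
    rw [hh, ← Ideal.span, Ideal.mem_span_singleton]
  refine ⟨⟨h, fun x hx => (hdvd x).1 hx, fun d hd => hd h ((hdvd h).2 dvd_rfl)⟩, fun Δ hΔ => ?_⟩
  obtain ⟨c, rfl⟩ := hΔ.dvd_of_dvd h fun x hx => (hdvd x).1 hx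
  have h0 : evalAtHom hγ ha h = 0 := hI ((hdvd h).2 dvd_rfl)
  rw [← evalAtHom_apply, map_mul, h0, zero_mul]

end
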